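/- Let $\Delta=\sum_{m\ge 0}q^{(2m+1)^2}\in\mathbf F_2[[q]]$ (the reduction modulo $2$ of $\sum_{k\ge1}\tau(k)q^k$). For an odd prime $p$ let $T_p$ be the Hecke operator on $\mathbf F_2[[q]]$ sending $\sum_m a_mq^m$ to $\sum_m (a_{pm}+a_{m/p})q^m$, where $a_{m/p}=0$ if $p\nmid m$. For an integer $n\ge 1$ let $\mathcal F(n)$ be the $\mathbf F_2$-vector space spanned by $\Delta,\Delta^3,\dots,\Delta^{2n-1}$. Then $\mathcal F(n)$ is stable under $T_p$ for every odd prime $p$, and the $\mathbf F_2$-subalgebra (with unit) $A(n)$ of $\operatorname{End}_{\mathbf F_2}(\mathcal F(n))$ generated by the restrictions to $\mathcal F(n)$ of all $T_p$, $p$ an odd prime, is generated by those of $T_3$ and $T_5$ alone. -/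

import Mathlib

noncomputable section

namespace ModTwoForms

/-- The series `Δ = ∑_{m ≥ 0} q ^ ((2 m + 1) ^ 2)` in `𝔽₂[[q]]`: its `k`-th coefficient is `1`
exactly when `k` is the square of an odd natural number. -/
def Delta : PowerSeries (ZMod 2) :=
  PowerSeries.mk fun k => if Odd k ∧ IsSquare k then 1 else 0

/-- The Hecke operator `T_p` on `𝔽₂[[q]]`: if `f = ∑ a_m q ^ m` then
`T_p f = ∑ (a_{p m} + a_{m / p}) q ^ m`, where `a_{m / p}` is read as `0` if `p` does not divide `m`.
(For `p` an odd prime, this is the reduction modulo 2 of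
`∑ (a_{p m} + p ^ (k - 1) a_{m / p}) q ^ m`, for every weight `k`.) -/
def hecke (p : ℕ) : PowerSeries (ZMod 2) →ₗ[ZMod 2] PowerSeries (ZMod 2) where
  toFun f := PowerSeries.mk fun m =>
    PowerSeries.coeff (p * m) f + if p ∣ m then PowerSeries.coeff (m / p) f else 0
  map_add' f g := by
    ext m
    simp only [PowerSeries.coeff_mk, map_add]
    split_ifs <;> ring
  map_smul' c f := by
    ext m
    simp only [PowerSeries.coeff_mk, map_smul, smul_eq_mul, RingHom.id_apply]
    split_ifs <;> ring

/-- `F n` is the span of `Δ, Δ ^ 3, …, Δ ^ (2 n - 1)` in `𝔽₂[[q]]`. -/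
def F (n : ℕ) : Submodule (ZMod 2) (PowerSeries (ZMod 2)) :=
  Submodule.span (ZMod 2) (Set.range fun i : Fin n => Delta ^ (2 * (i : ℕ) + 1))

/-- `F n` is stable under the operators `T_p`, for `p` an odd prime. -/
def HeckeStable (n : ℕ) : Prop :=
  ∀ p : ℕ, p.Prime → p ≠ 2 → ∀ f ∈ F n, hecke p f ∈ F n

/-- The endomorphism of `F n` induced by `T_p`, for `p` an odd prime. -/
def T {n : ℕ} (h : HeckeStable n) (p : ℕ) (hp : p.Prime) (hp2 : p ≠ 2) :
    Module.End (ZMod 2) (F n) :=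
  (hecke p).restrict (h p hp hp2)

/-- The Hecke algebra `A n`: the (unital) `𝔽₂`-subalgebra of `End (F n)` generated by all `T_p`,
for `p` an odd prime. -/
def A {n : ℕ} (h : HeckeStable n) : Subalgebra (ZMod 2) (Module.End (ZMod 2) (F n)) :=
  Algebra.adjoin (ZMod 2) {u | ∃ (p : ℕ) (hp : p.Prime) (hp2 : p ≠ 2), u = T h p hp hp2}

end ModTwoForms

end

noncomputable section

namespace ModTwoForms

/-! ### Parity of binomial coefficients, digit by digit -/

section Lucas

/-! The argument is duality through the linear form `a_1`. Let `B` be the algebra generated by `T_3`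
and `T_5` on `F n`. Both operators map `F (m + 1)` into `F m`, and their common kernel on `F n` lies
in the line of `Δ` (`eq_smul_Delta_of_hecke_eq_zero`), where `a_1` does not vanish. Hence a `v` with
`a_1 (u v) = 0` for every `u` in `B` is zero, and the forms `a_1 ∘ u` fill the dual of `F n`. Given
`p`, choose `u` in `B` with `a_1 ∘ T_p = a_1 ∘ u`. As `T_p - u` commutes with `B`, `a_1 (w ((T_p -
u) v)) = a_1 ((T_p - u) (w v)) = 0` for all `w` in `B`, so `T_p = u`.

The common kernel is found by explicit computation. The modular equations of levels 3 and 5 modulo 2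
(`Delta_mul_expand_three`, `Delta_mul_expand_five`), proved by counting representations by binary
quadratic forms with involutions, give linear recurrences in `k` for `T_3` and `T_5` on `Δ ^ k`,
solved by binomial coefficients. On odd powers, with `Δ ^ (2 c + 1)` written `t ^ c`, these become
`binomialOp 2 1` and `binomialOp 4 2`. Split the binary digits of `c` by position into two numbers
`e` and `o` (`evenDigits`, `oddDigits`). Both operators lower `e + o`; up to terms that are lower in
a suitable order, `T_3` lowers `e` by one and `T_5` lowers `o` by one. So a polynomial killed by
both is constant (`eq_C_of_binomialOp_eq_zero`).

Stability of `F n` comes from characteristic zero. The reduction of `p T_p` modulo 2 is `T_p`, since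
`p` is odd; `p T_p` preserves level one forms of weight `12 k` and integrality; and such integral
forms reduce to polynomials in `Δ` of degree at most `k` (`modTwo_mem_powersUpTo`). Parity of
exponents then keeps only odd powers. -/

lemma odd_choose_iff_mod_two (n k : ℕ) :
    Odd (n.choose k) ↔ Odd ((n % 2).choose (k % 2)) ∧ Odd ((n / 2).choose (k / 2)) := by
  have : Fact (Nat.Prime 2) := ⟨Nat.prime_two⟩
  have h := Choose.choose_modEq_choose_mod_mul_choose_div_nat (p := 2) (n := n) (k := k)
  rw [← Nat.odd_mul]
  simp only [Nat.odd_iff]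
  rw [h]

/-- Lucas's theorem modulo `2`, in base `2 ^ m`. -/
lemma odd_choose_iff_mod_two_pow (m n k : ℕ) :
    Odd (n.choose k) ↔
      Odd ((n % 2 ^ m).choose (k % 2 ^ m)) ∧ Odd ((n / 2 ^ m).choose (k / 2 ^ m)) := by
  induction m generalizing n k with
  | zero => simp [Nat.mod_one]
  | succ m ih =>
    rw [odd_choose_iff_mod_two, ih (n / 2), odd_choose_iff_mod_two (n % 2 ^ (m + 1))]
    have h1 (a : ℕ) : a % 2 ^ (m + 1) % 2 = a % 2 :=
      Nat.mod_mod_of_dvd _ (dvd_pow_self 2 (Nat.succ_ne_zero m))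
    have h2 (a : ℕ) : a % 2 ^ (m + 1) / 2 = a / 2 % 2 ^ m := by
      rw [pow_succ', Nat.mod_mul_right_div_self]
    have h3 (a : ℕ) : a / 2 / 2 ^ m = a / 2 ^ (m + 1) := by
      rw [Nat.div_div_eq_div_mul, pow_succ']
    rw [h1, h1, h2, h2, h3, h3, and_assoc]

lemma odd_choose_four_mul_add {a b r s : ℕ} (hr : r < 4) (hs : s < 4) :
    Odd ((4 * a + r).choose (4 * b + s)) ↔ Odd (r.choose s) ∧ Odd (a.choose b) := by
  rw [odd_choose_iff_mod_two_pow 2]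
  norm_num [Nat.mul_add_mod, Nat.mod_eq_of_lt hr, Nat.mod_eq_of_lt hs]
  rw [show (4 * a + r) / 4 = a by omega, show (4 * b + s) / 4 = b by omega]
  exact fun _ => Iff.rfl

lemma odd_choose_eight_mul_add {a b r s : ℕ} (hr : r < 8) (hs : s < 8) :
    Odd ((8 * a + r).choose (8 * b + s)) ↔ Odd (r.choose s) ∧ Odd (a.choose b) := by
  rw [odd_choose_iff_mod_two_pow 3]
  norm_num [Nat.mul_add_mod, Nat.mod_eq_of_lt hr, Nat.mod_eq_of_lt hs]
  rw [show (8 * a + r) / 8 = a by omega, show (8 * b + s) / 8 = b by omega]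
  exact fun _ => Iff.rfl

end Lucas

/-! ### The two halves of the binary expansion of an exponent -/

section Code

/-- `evenDigits c = ∑ i, β_{2i} 2 ^ i`, where `c = ∑ i, β_i 2 ^ i` in base `2`. -/
def evenDigits (c : ℕ) : ℕ := if c = 0 then 0 else c % 2 + 2 * evenDigits (c / 4)
decreasing_by omega

/-- `oddDigits c = ∑ i, β_{2i+1} 2 ^ i`, where `c = ∑ i, β_i 2 ^ i` in base `2`. -/
def oddDigits (c : ℕ) : ℕ := if c = 0 then 0 else c / 2 % 2 + 2 * oddDigits (c / 4)
decreasing_by omega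

lemma evenDigits_zero : evenDigits 0 = 0 := by rw [evenDigits]; rfl

lemma oddDigits_zero : oddDigits 0 = 0 := by rw [oddDigits]; rfl

lemma evenDigits_four_mul_add {a r : ℕ} (hr : r < 4) :
    evenDigits (4 * a + r) = r % 2 + 2 * evenDigits a := by
  rcases Nat.eq_zero_or_pos (4 * a + r) with h | h
  · obtain ⟨rfl, rfl⟩ : a = 0 ∧ r = 0 := by omega
    simp [evenDigits_zero]
  · rw [evenDigits, if_neg h.ne', show (4 * a + r) % 2 = r % 2 by omega,
      show (4 * a + r) / 4 = a by omega]

lemma oddDigits_four_mul_add {a r : ℕ} (hr : r < 4) :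
    oddDigits (4 * a + r) = r / 2 + 2 * oddDigits a := by
  rcases Nat.eq_zero_or_pos (4 * a + r) with h | h
  · obtain ⟨rfl, rfl⟩ : a = 0 ∧ r = 0 := by omega
    simp [oddDigits_zero]
  · rw [oddDigits, if_neg h.ne', show (4 * a + r) / 2 % 2 = r / 2 by omega,
      show (4 * a + r) / 4 = a by omega]

lemma eq_of_digits_eq (a b : ℕ) (he : evenDigits a = evenDigits b)
    (ho : oddDigits a = oddDigits b) : a = b := by
  induction a using Nat.strong_induction_on generalizing b with
  | _ a ih =>
    obtain ⟨a, r, hr, rfl⟩ : ∃ a' r, r < 4 ∧ a = 4 * a' + r :=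
      ⟨a / 4, a % 4, by omega, by omega⟩
    obtain ⟨b, s, hs, rfl⟩ : ∃ b' s, s < 4 ∧ b = 4 * b' + s :=
      ⟨b / 4, b % 4, by omega, by omega⟩
    rw [evenDigits_four_mul_add hr, evenDigits_four_mul_add hs] at he
    rw [oddDigits_four_mul_add hr, oddDigits_four_mul_add hs] at ho
    obtain rfl : r = s := by omega
    -- When `4 * a + r = 0` the quotient `a` is not smaller, so the induction hypothesis does not
    -- apply and zero is treated apart.
    by_cases h : a = 0 ∧ r = 0
    · obtain ⟨rfl, rfl⟩ := h
      rw [evenDigits_zero] at he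
      rw [oddDigits_zero] at ho
      by_contra hb
      have key (c : ℕ) : evenDigits c = 0 → oddDigits c = 0 → c = 0 := by
        induction c using Nat.strong_induction_on with
        | _ c ih =>
          intro h1 h2
          by_contra hc
          rw [evenDigits, if_neg hc] at h1
          rw [oddDigits, if_neg hc] at h2
          have := ih (c / 4) (by omega) (by omega) (by omega)
          omega
      have := key b (by omega) (by omega)
      omega
    · rw [ih a (by omega) b (by omega) (by omega)]

/-- The weight of a natural number: `α` and `β` are the weights of the two kinds of digits. -/
def weight (α β c : ℕ) : ℕ := α * evenDigits c + β * oddDigits c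

lemma weight_four_mul_add (α β : ℕ) {a r : ℕ} (hr : r < 4) :
    weight α β (4 * a + r) = α * (r % 2) + β * (r / 2) + 2 * weight α β a := by
  rw [weight, evenDigits_four_mul_add hr, oddDigits_four_mul_add hr, weight]
  ring

end Code

/-! ### A finite automaton bounding the drop in weight -/

section Automaton

/-- A finite list of states `(e, s, γ, d)` is closed if reading one base `4` digit of `c` and of
`g` in `(c + g + e).choose ((B + 2) * g + s)` and `c - B * g - γ` leads from a state to a state, and
the numbers `d` bound the decrease of the weight. -/
def IsClosedTable (B α β : ℕ) (t : List (ℕ × ℕ × ℕ × ℕ)) : Prop :=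
  ∀ a ∈ t, (a.2.2.1 = 0 → Odd (a.1.choose a.2.1) → a.2.2.2 = 0) ∧
    ∀ r < 4, ∀ q < 4, Odd (((r + q + a.1) % 4).choose (((B + 2) * q + a.2.1) % 4)) →
      ∃ b ∈ t, b.1 = (r + q + a.1) / 4 ∧ b.2.1 = ((B + 2) * q + a.2.1) / 4 ∧
        ∃ ρ < 4, 4 * b.2.2.1 + r = ρ + B * q + a.2.2.1 ∧
          α * (ρ % 2) + β * (ρ / 2) + a.2.2.2 ≤ α * (r % 2) + β * (r / 2) + 2 * b.2.2.2

instance (B α β : ℕ) (t : List (ℕ × ℕ × ℕ × ℕ)) : Decidable (IsClosedTable B α β t) := by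
  unfold IsClosedTable
  infer_instance

/-- By Lucas in base 4, oddness of the binomial coefficient is a condition on the last digits
together with the same condition on the quotients. The carries into its top and bottom and the
borrow in `c - B * g` are the new `e`, `s`, `γ`. The weight doubles under this shift, which is why
`d` is counted twice in the transition; induction on `c` then follows the table. -/
lemma IsClosedTable.weight_add_le {B α β : ℕ} (hB : 0 < B) {t : List (ℕ × ℕ × ℕ × ℕ)}
    (ht : IsClosedTable B α β t) (c : ℕ) {e s γ d : ℕ} (ha : (e, s, γ, d) ∈ t) {g x : ℕ}
    (hx : x + B * g + γ = c) (h : Odd ((c + g + e).choose ((B + 2) * g + s))) :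
    weight α β x + d ≤ weight α β c := by
  induction c using Nat.strong_induction_on generalizing e s γ d g x with
  | _ c ih =>
    rcases Nat.eq_zero_or_pos c with rfl | hc
    · obtain rfl : g = 0 := by
        by_contra hg
        have : 0 < B * g := Nat.mul_pos hB (Nat.pos_of_ne_zero hg)
        omega
      obtain ⟨rfl, rfl⟩ : x = 0 ∧ γ = 0 := by omega
      have hd : d = 0 := (ht _ ha).1 rfl (by simpa using h)
      simp [hd]
    · obtain ⟨c, r, hr, rfl⟩ : ∃ c' r, r < 4 ∧ c = 4 * c' + r :=
        ⟨c / 4, c % 4, by omega, by omega⟩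
      obtain ⟨g, q, hq, rfl⟩ : ∃ g' q, q < 4 ∧ g = 4 * g' + q :=
        ⟨g / 4, g % 4, by omega, by omega⟩
      obtain ⟨m, hm⟩ : ∃ m, m = r + q + e := ⟨_, rfl⟩
      obtain ⟨l, hl⟩ : ∃ l, l = (B + 2) * q + s := ⟨_, rfl⟩
      rw [show 4 * c + r + (4 * g + q) + e = 4 * (c + g + m / 4) + m % 4 by omega,
        show (B + 2) * (4 * g + q) + s = 4 * ((B + 2) * g + l / 4) + l % 4 by
          rw [mul_add, add_assoc, ← hl, mul_left_comm]; omega,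
        odd_choose_four_mul_add (by omega) (by omega)] at h
      obtain ⟨⟨e', s', γ', d'⟩, hb, he', hs', ρ, hρ, hγ, hw⟩ :=
        (ht _ ha).2 r hr q hq (by simpa [← hm, ← hl] using h.1)
      simp only at he' hs' hγ hw
      rw [← hm] at he'
      rw [← hl] at hs'
      have hx' : x + 4 * (B * g) + B * q + γ = 4 * c + r := by
        rw [← hx]; ring
      obtain ⟨x, rfl⟩ : ∃ x', x = 4 * x' + ρ := ⟨x / 4, by omega⟩
      have := ih c (by omega) hb (g := g) (x := x) (by omega) (by rw [he', hs']; exact h.2)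
      rw [weight_four_mul_add _ _ hρ, weight_four_mul_add _ _ hr]
      omega

end Automaton

/-! ### How `T_3` and `T_5` move the digits of exponents -/

section Height

/-- The transitions of `T_3` on the exponents, in terms of `evenDigits + oddDigits`. -/
lemma weight_le_of_odd_choose_three {c g x : ℕ} (hx : x + 2 * g + 1 = c)
    (h : Odd ((c + g).choose (4 * g + 1))) :
    weight 1 1 x + 1 ≤ weight 1 1 c ∧ weight 2 3 x + 2 ≤ weight 2 3 c := by
  constructor
  -- The initial state is `(0, 1, 1, 1)`, whose last entry is the decrease claimed; closure of the
  -- table is a finite check.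
  · have ht : IsClosedTable 2 1 1 [(1, 2, 1, 0), (0, 2, 1, 0), (1, 3, 2, 1), (1, 1, 0, 0),
        (0, 1, 0, 0), (0, 0, 0, 0), (1, 3, 1, 0), (0, 2, 2, 1), (0, 3, 2, 1), (0, 1, 1, 1)] := by
      decide +kernel
    exact ht.weight_add_le two_pos c (e := 0) (s := 1) (γ := 1) (by simp) hx h
  -- Since `2 e + 3 o = 2 (e + o) + o`, this second weight compares the values of `o` when `e + o`
  -- drops by exactly one.
  · have ht : IsClosedTable 2 2 3 [(1, 2, 1, 1), (0, 2, 1, 1), (1, 3, 2, 3), (1, 1, 0, 0),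
        (0, 1, 0, 0), (0, 0, 0, 0), (1, 3, 1, 1), (0, 2, 2, 3), (0, 3, 2, 3), (0, 1, 1, 2)] := by
      decide +kernel
    exact ht.weight_add_le two_pos c (e := 0) (s := 1) (γ := 1) (by simp) hx h

/-- The transitions of `T_5` on the exponents, in terms of `evenDigits + oddDigits`. -/
lemma weight_le_of_odd_choose_five {c g x : ℕ} (hx : x + 4 * g + 2 = c)
    (h : Odd ((c + g).choose (6 * g + 2))) :
    weight 1 1 x + 1 ≤ weight 1 1 c ∧ weight 2 3 x + 3 ≤ weight 2 3 c := by
  constructor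
  · have ht : IsClosedTable 4 1 1 [(1, 2, 1, 0), (0, 2, 1, 0), (1, 3, 2, 1), (1, 1, 0, 0),
        (1, 5, 4, 2), (0, 1, 0, 0), (0, 5, 4, 2), (0, 0, 0, 0), (0, 4, 4, 2), (0, 3, 3, 1),
        (1, 4, 3, 1), (0, 4, 3, 1), (1, 5, 3, 1), (1, 4, 2, 1), (0, 2, 2, 1), (0, 3, 2, 1),
        (0, 1, 1, 1)] := by
      decide +kernel
    exact ht.weight_add_le four_pos c (e := 0) (s := 2) (γ := 2) (by simp) hx h
  · have ht : IsClosedTable 4 2 3 [(1, 2, 1, 1), (0, 2, 1, 1), (1, 3, 2, 3), (1, 1, 0, 0),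
        (1, 5, 4, 4), (0, 1, 0, 0), (0, 5, 4, 4), (0, 0, 0, 0), (0, 4, 4, 4), (0, 3, 3, 4),
        (1, 4, 3, 2), (0, 4, 3, 2), (1, 5, 3, 2), (1, 4, 2, 1), (0, 2, 2, 3), (0, 3, 2, 3),
        (0, 1, 1, 2)] := by
      decide +kernel
    exact ht.weight_add_le four_pos c (e := 0) (s := 2) (γ := 2) (by simp) hx h

/-- This is the dominant term of `T_3`: subtract one from the number formed by the digits in even
positions. If the lowest digit is 1 it is dropped (`g = 0`). Otherwise a borrow sets it to 1 and
passes to the next base 4 digit, which turns `g` into `4 * g + 1`. -/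
lemma exists_evenDigits_pred (c : ℕ) (hc : 0 < evenDigits c) :
    ∃ x g, x + 2 * g + 1 = c ∧ Odd ((c + g).choose (4 * g + 1)) ∧
      evenDigits x + 1 = evenDigits c ∧ oddDigits x = oddDigits c := by
  induction c using Nat.strong_induction_on with
  | _ c ih =>
    obtain ⟨c, r, hr, rfl⟩ : ∃ c' r, r < 4 ∧ c = 4 * c' + r :=
      ⟨c / 4, c % 4, by omega, by omega⟩
    by_cases h2 : r % 2 = 1
    · refine ⟨4 * c + (r - 1), 0, by omega, ?_, ?_, ?_⟩
      · simp only [add_zero, mul_zero, zero_add, Nat.choose_one_right, Nat.odd_iff]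
        omega
      · rw [evenDigits_four_mul_add (by omega), evenDigits_four_mul_add hr]
        omega
      · rw [oddDigits_four_mul_add (by omega), oddDigits_four_mul_add hr]
        omega
    · rw [evenDigits_four_mul_add hr] at hc ⊢
      rw [oddDigits_four_mul_add hr]
      have hc0 : c ≠ 0 := by
        rintro rfl
        rw [evenDigits_zero] at hc
        omega
      obtain ⟨x, g, hx, hodd, he, ho⟩ := ih c (by omega) (by omega)
      refine ⟨4 * x + (r + 1), 4 * g + 1, by omega, ?_, ?_, ?_⟩
      · rw [show 4 * c + r + (4 * g + 1) = 4 * (c + g) + (r + 1) by ring,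
          show 4 * (4 * g + 1) + 1 = 4 * (4 * g + 1) + 1 by ring,
          odd_choose_four_mul_add (by omega) (by norm_num)]
        refine ⟨?_, hodd⟩
        rw [Nat.choose_one_right, Nat.odd_iff]
        omega
      · rw [evenDigits_four_mul_add (by omega)]
        omega
      · rw [oddDigits_four_mul_add (by omega)]
        omega

/-- The same subtraction with borrow on the digits in odd positions gives the dominant term of
`T_5`. -/
lemma exists_oddDigits_pred (c : ℕ) (hc : 0 < oddDigits c) :
    ∃ x g, x + 4 * g + 2 = c ∧ Odd ((c + g).choose (6 * g + 2)) ∧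
      evenDigits x = evenDigits c ∧ oddDigits x + 1 = oddDigits c := by
  induction c using Nat.strong_induction_on with
  | _ c ih =>
    obtain ⟨c, r, hr, rfl⟩ : ∃ c' r, r < 4 ∧ c = 4 * c' + r :=
      ⟨c / 4, c % 4, by omega, by omega⟩
    by_cases h2 : 2 ≤ r
    · refine ⟨4 * c + (r - 2), 0, by omega, ?_, ?_, ?_⟩
      · rw [show 4 * c + r + 0 = 4 * c + r by ring, show 6 * 0 + 2 = 4 * 0 + 2 by ring,
          odd_choose_four_mul_add hr (by norm_num)]
        obtain rfl | rfl : r = 2 ∨ r = 3 := by omega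
        · simp
        · simp only [Nat.choose_zero_right, odd_one, and_true]
          decide
      · rw [evenDigits_four_mul_add (by omega), evenDigits_four_mul_add hr]
        omega
      · rw [oddDigits_four_mul_add (by omega), oddDigits_four_mul_add hr]
        omega
    · rw [oddDigits_four_mul_add hr] at hc ⊢
      rw [evenDigits_four_mul_add hr]
      have hc0 : c ≠ 0 := by
        rintro rfl
        rw [oddDigits_zero] at hc
        omega
      obtain ⟨x, g, hx, hodd, he, ho⟩ := ih c (by omega) (by omega)
      refine ⟨4 * x + (r + 2), 4 * g + 1, by omega, ?_, ?_, ?_⟩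
      · rw [show 4 * c + r + (4 * g + 1) = 4 * (c + g) + (r + 1) by ring,
          show 6 * (4 * g + 1) + 2 = 4 * (6 * g + 2) + 0 by ring,
          odd_choose_four_mul_add (by omega) (by norm_num)]
        exact ⟨by simp, hodd⟩
      · rw [evenDigits_four_mul_add (by omega)]
        omega
      · rw [oddDigits_four_mul_add (by omega)]
        omega

end Height

/-! ### The common kernel of the two binomial operators -/

section Kernel

open Polynomial

/-- The linear endomorphism of `𝔽₂[t]` sending `t ^ c` to
`∑_g (c + g).choose ((B + 2) * g + s) t ^ (c - (B * g + s))`. -/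
def binomialOp (B s : ℕ) : (ZMod 2)[X] →ₗ[ZMod 2] (ZMod 2)[X] :=
  Polynomial.lsum fun c => LinearMap.toSpanSingleton (ZMod 2) _ <|
    ∑ g ∈ Finset.range (c + 1), ((c + g).choose ((B + 2) * g + s) : (ZMod 2)[X]) *
      X ^ (c - (B * g + s))

lemma binomialOp_X_pow (B s c : ℕ) :
    binomialOp B s (X ^ c) = ∑ g ∈ Finset.range (c + 1),
      ((c + g).choose ((B + 2) * g + s) : (ZMod 2)[X]) * X ^ (c - (B * g + s)) := by
  rw [binomialOp, ← monomial_one_right_eq_X_pow, lsum_apply, sum_monomial_index] <;> simp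

lemma natCast_zmod_two_eq_ite (n : ℕ) [Decidable (Odd n)] :
    (n : ZMod 2) = if Odd n then 1 else 0 := by
  split_ifs with h
  · exact ZMod.natCast_eq_one_iff_odd.mpr h
  · exact ZMod.natCast_eq_zero_iff_even.mpr (Nat.not_odd_iff_even.mp h)

open Classical in
lemma coeff_binomialOp_X_pow {B : ℕ} (hB : 0 < B) (s c x : ℕ) :
    (binomialOp B s (X ^ c)).coeff x =
      if ∃ g, x + B * g + s = c ∧ Odd ((c + g).choose ((B + 2) * g + s)) then 1 else 0 := by
  rw [binomialOp_X_pow, finsetSum_coeff]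
  have hterm (g : ℕ) : (((c + g).choose ((B + 2) * g + s) : (ZMod 2)[X]) *
      X ^ (c - (B * g + s))).coeff x =
      if x + B * g + s = c ∧ Odd ((c + g).choose ((B + 2) * g + s)) then 1 else 0 := by
    rw [← C_eq_natCast, coeff_C_mul_X_pow, natCast_zmod_two_eq_ite]
    by_cases hodd : Odd ((c + g).choose ((B + 2) * g + s))
    -- A nonzero coefficient forces `B * g + s ≤ c`, so the truncated subtraction in the exponent is
    -- a true one.
    · have hle : (B + 2) * g + s ≤ c + g := by
        by_contra hlt
        rw [Nat.choose_eq_zero_of_lt (by omega)] at hodd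
        simp at hodd
      have : (B + 2) * g = B * g + 2 * g := by ring
      simp only [hodd, and_true, if_true]
      congr 1
      apply propext
      omega
    · simp [hodd]
  simp_rw [hterm]
  by_cases h : ∃ g, x + B * g + s = c ∧ Odd ((c + g).choose ((B + 2) * g + s))
  · obtain ⟨g, hg⟩ := h
    rw [if_pos ⟨g, hg⟩, Finset.sum_eq_single g, if_pos hg]
    · intro g' _ hne
      rw [if_neg]
      rintro ⟨h1, -⟩
      exact hne (Nat.eq_of_mul_eq_mul_left hB (by omega))
    · intro hmem
      have : g ≤ B * g := Nat.le_mul_of_pos_left g hB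
      exact absurd (Finset.mem_range.mpr (by omega)) hmem
  · rw [if_neg h, Finset.sum_eq_zero]
    exact fun g _ => if_neg fun hg => h ⟨g, hg⟩

/-- When a single monomial of `f` contributes to degree `x`, nothing can cancel its contribution. -/
lemma coeff_binomialOp_ne_zero {B : ℕ} (hB : 0 < B) {s c x g : ℕ} {f : (ZMod 2)[X]}
    (hc : c ∈ f.support) (hx : x + B * g + s = c)
    (hodd : Odd ((c + g).choose ((B + 2) * g + s)))
    (huniq : ∀ c' ∈ f.support, ∀ g', x + B * g' + s = c' →
      Odd ((c' + g').choose ((B + 2) * g' + s)) → c' = c) :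
    (binomialOp B s f).coeff x ≠ 0 := by
  classical
  conv_lhs => rw [f.as_sum_support_C_mul_X_pow, map_sum, finsetSum_coeff]
  simp_rw [← smul_eq_C_mul, map_smul, coeff_smul, coeff_binomialOp_X_pow hB]
  rw [Finset.sum_eq_single c, if_pos ⟨g, hx, hodd⟩, smul_eq_mul, mul_one]
  · exact mem_support_iff.mp hc
  · intro c' hc' hne
    rw [if_neg, smul_zero]
    rintro ⟨g', h1, h2⟩
    exact hne (huniq c' hc' g' h1 h2)
  · exact fun h => absurd hc h

/-- The joint kernel of the operators corresponding to `T_3` and `T_5` consists of constants. -/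
lemma eq_C_of_binomialOp_eq_zero {f : (ZMod 2)[X]} (h3 : binomialOp 2 1 f = 0)
    (h5 : binomialOp 4 2 f = 0) : f = C (f.coeff 0) := by
  rcases f.support.eq_empty_or_nonempty with h0 | hne
  · rw [support_eq_empty.mp h0]
    simp
  obtain ⟨c₁, hc₁, hmax₁⟩ := f.support.exists_max_image (weight 1 1) hne
  -- The leading exponent `c` maximizes `e + o` first and then `o`.
  obtain ⟨c, hc, hmax⟩ := (f.support.filter fun c => weight 1 1 c = weight 1 1 c₁).exists_max_image
    oddDigits ⟨c₁, by simp [mem_support_iff.mp hc₁]⟩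
  rw [Finset.mem_filter] at hc
  have hh (c' : ℕ) (hc' : c' ∈ f.support) : weight 1 1 c' ≤ weight 1 1 c :=
    hc.2 ▸ hmax₁ c' hc'
  have ho (c' : ℕ) (hc' : c' ∈ f.support) (h : weight 1 1 c' = weight 1 1 c) :
      oddDigits c' ≤ oddDigits c :=
    hmax c' (Finset.mem_filter.mpr ⟨hc', h.trans hc.2⟩)
  simp only [weight] at hh ho
  by_cases he : 0 < evenDigits c
  · obtain ⟨x, g, hx, hodd, hxe, hxo⟩ := exists_evenDigits_pred c he
    refine absurd (congrArg (fun p => p.coeff x) h3)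
      (coeff_binomialOp_ne_zero two_pos hc.1 hx hodd fun c' hc' g' hg' hodd' => ?_)
    -- If `c'` also reaches `x`, the first bound forces `e + o` to be the same at `c'` as at `c`;
    -- the second then gives `o(c') ≥ o(c)`. Maximality makes both digit numbers agree, so `c' = c`.
    have := weight_le_of_odd_choose_three hg' hodd'
    simp only [weight] at this
    have h1 := hh c' hc'
    have h2 := ho c' hc' (by omega)
    exact eq_of_digits_eq _ _ (by omega) (by omega)
  by_cases ho' : 0 < oddDigits c
  · obtain ⟨x, g, hx, hodd, hxe, hxo⟩ := exists_oddDigits_pred c ho'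
    refine absurd (congrArg (fun p => p.coeff x) h5)
      (coeff_binomialOp_ne_zero four_pos hc.1 hx hodd fun c' hc' g' hg' hodd' => ?_)
    have := weight_le_of_odd_choose_five hg' hodd'
    simp only [weight] at this
    have h1 := hh c' hc'
    have h2 := ho c' hc' (by omega)
    exact eq_of_digits_eq _ _ (by omega) (by omega)
  ext n
  rw [coeff_C]
  split_ifs with hn
  · rw [hn]
  · by_contra hfn
    have := hh n (mem_support_iff.mpr hfn)
    exact hn (eq_of_digits_eq _ _ (by rw [evenDigits_zero]; omega) (by rw [oddDigits_zero]; omega))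

/-- The operators strictly lower degrees. -/
lemma binomialOp_mem_degreeLT {B s n : ℕ} (hs : 0 < s) {f : (ZMod 2)[X]}
    (hf : f ∈ degreeLT (ZMod 2) (n + 1)) : binomialOp B s f ∈ degreeLT (ZMod 2) n := by
  conv in f => rw [f.as_sum_support_C_mul_X_pow]
  rw [map_sum]
  refine Submodule.sum_mem _ fun c hc => ?_
  rw [← smul_eq_C_mul, map_smul, binomialOp_X_pow]
  refine Submodule.smul_mem _ _ (Submodule.sum_mem _ fun g _ => ?_)
  have hcn : c < n + 1 := by
    have := (le_degree_of_mem_supp c hc).trans_lt (mem_degreeLT.mp hf)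
    exact_mod_cast this
  by_cases hle : (B + 2) * g + s ≤ c + g
  · rw [← C_eq_natCast, ← smul_eq_C_mul]
    refine Submodule.smul_mem _ _ (mem_degreeLT.mpr ?_)
    rw [degree_X_pow]
    have : (B + 2) * g = B * g + 2 * g := by ring
    exact_mod_cast (show c - (B * g + s) < n by omega)
  · rw [Nat.choose_eq_zero_of_lt (by omega)]
    simp

end Kernel

end ModTwoForms

end

noncomputable section

namespace ModTwoForms

open PowerSeries Finset

/-! ### Theta series modulo 2 as counts of representations -/

section Theta

/-- The integers `x` satisfying `P` with `a * x ^ 2 = n`. -/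
def unaryReps (P : ℤ → Prop) [DecidablePred P] (a n : ℕ) : Finset ℤ :=
  {x ∈ Icc (-n : ℤ) n | P x ∧ a * x ^ 2 = n}

/-- The pairs of integers satisfying `P` with `a * x ^ 2 + b * y ^ 2 = n`. -/
def binaryReps (P : ℤ × ℤ → Prop) [DecidablePred P] (a b n : ℕ) : Finset (ℤ × ℤ) :=
  {z ∈ Icc (-n : ℤ) n ×ˢ Icc (-n : ℤ) n | P z ∧ a * z.1 ^ 2 + b * z.2 ^ 2 = n}

lemma abs_le_of_mul_sq_le {a n : ℕ} (ha : 0 < a) {x : ℤ} (h : a * x ^ 2 ≤ n) : |x| ≤ n := by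
  have ha' : (1 : ℤ) ≤ a := by exact_mod_cast ha
  have h1 : |x| ≤ x ^ 2 := by
    rw [← sq_abs]
    rcases (abs_nonneg x).eq_or_lt with h0 | h0
    · rw [← h0]; norm_num
    · nlinarith
  nlinarith [sq_nonneg x]

lemma mem_unaryReps {P : ℤ → Prop} [DecidablePred P] {a : ℕ} (ha : 0 < a) {n : ℕ} {x : ℤ} :
    x ∈ unaryReps P a n ↔ P x ∧ a * x ^ 2 = n := by
  rw [unaryReps, mem_filter, mem_Icc, ← abs_le, and_iff_right_iff_imp]
  exact fun h => abs_le_of_mul_sq_le ha h.2.le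

lemma mem_binaryReps {P : ℤ × ℤ → Prop} [DecidablePred P] {a b : ℕ} (ha : 0 < a) (hb : 0 < b)
    {n : ℕ} {z : ℤ × ℤ} :
    z ∈ binaryReps P a b n ↔ P z ∧ a * z.1 ^ 2 + b * z.2 ^ 2 = n := by
  rw [binaryReps, mem_filter, mem_product, mem_Icc, mem_Icc, ← abs_le, ← abs_le,
    and_iff_right_iff_imp]
  intro h
  have h1 : (0 : ℤ) ≤ a * z.1 ^ 2 := by positivity
  have h2 : (0 : ℤ) ≤ b * z.2 ^ 2 := by positivity
  exact ⟨abs_le_of_mul_sq_le ha (by linarith [h.2]), abs_le_of_mul_sq_le hb (by linarith [h.2])⟩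

/-- The theta series `∑ q ^ (a * x ^ 2)` over the integers `x` satisfying `P`. -/
def theta (P : ℤ → Prop) [DecidablePred P] (a : ℕ) : PowerSeries (ZMod 2) :=
  PowerSeries.mk fun n => (#(unaryReps P a n) : ZMod 2)

lemma coeff_theta (P : ℤ → Prop) [DecidablePred P] (a n : ℕ) :
    coeff n (theta P a) = (#(unaryReps P a n) : ZMod 2) :=
  coeff_mk _ _

lemma coeff_theta_mul_theta (P Q : ℤ → Prop) [DecidablePred P] [DecidablePred Q] {a b : ℕ}
    (ha : 0 < a) (hb : 0 < b) (n : ℕ) :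
    coeff n (theta P a * theta Q b) =
      (#(binaryReps (fun z => P z.1 ∧ Q z.2) a b n) : ZMod 2) := by
  have h : binaryReps (fun z => P z.1 ∧ Q z.2) a b n =
      (antidiagonal n).biUnion fun i => unaryReps P a i.1 ×ˢ unaryReps Q b i.2 := by
    ext ⟨x, y⟩
    simp only [mem_binaryReps ha hb, mem_biUnion, mem_product, mem_unaryReps ha, mem_unaryReps hb,
      HasAntidiagonal.mem_antidiagonal]
    constructor
    · rintro ⟨⟨hP, hQ⟩, h⟩
      refine ⟨((a * x ^ 2).toNat, (b * y ^ 2).toNat), ?_, ⟨hP, ?_⟩, hQ, ?_⟩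
      · have h1 : (0 : ℤ) ≤ a * x ^ 2 := by positivity
        have h2 : (0 : ℤ) ≤ b * y ^ 2 := by positivity
        simp only at h ⊢
        omega
      · exact (Int.toNat_of_nonneg (by positivity)).symm
      · exact (Int.toNat_of_nonneg (by positivity)).symm
    · rintro ⟨⟨i, j⟩, hij, ⟨hP, hi⟩, hQ, hj⟩
      simp only at hij hi hj ⊢
      exact ⟨⟨hP, hQ⟩, by rw [hi, hj, ← hij]; push_cast; ring⟩
  rw [h, card_biUnion, coeff_mul]
  · simp only [coeff_theta, card_product]
    push_cast
    rfl
  · rintro ⟨i, j⟩ - ⟨i', j'⟩ - hne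
    rw [Function.onFun, disjoint_left]
    rintro ⟨x, y⟩ h1 h2
    simp only [mem_product, mem_unaryReps ha, mem_unaryReps hb] at h1 h2
    refine hne ?_
    rw [Prod.mk.injEq]
    constructor
    · exact_mod_cast h1.1.2.symm.trans h2.1.2
    · exact_mod_cast h1.2.2.symm.trans h2.2.2

lemma expand_theta (P : ℤ → Prop) [DecidablePred P] {a : ℕ} (ha : 0 < a) {m : ℕ} (hm : m ≠ 0) :
    expand m hm (theta P a) = theta P (m * a) := by
  have hm' : (m : ℤ) ≠ 0 := by exact_mod_cast hm
  have hma : 0 < m * a := Nat.mul_pos (Nat.pos_of_ne_zero hm) ha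
  ext n
  rw [coeff_expand]
  split_ifs with h
  · obtain ⟨n, rfl⟩ := h
    rw [Nat.mul_div_cancel_left _ (Nat.pos_of_ne_zero hm), coeff_theta, coeff_theta]
    congr 2
    ext x
    rw [mem_unaryReps ha, mem_unaryReps hma]
    push_cast
    rw [mul_assoc, mul_right_inj' hm']
  · rw [coeff_theta, eq_comm]
    convert Nat.cast_zero
    rw [card_eq_zero, eq_empty_iff_forall_notMem]
    intro x hx
    rw [mem_unaryReps hma] at hx
    refine h ?_
    have : (m : ℤ) ∣ n := ⟨a * x ^ 2, by rw [← hx.2]; push_cast; ring⟩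
    exact_mod_cast this

lemma theta_neg (P : ℤ → Prop) [DecidablePred P] {a : ℕ} (ha : 0 < a) :
    theta (fun x => P (-x)) a = theta P a := by
  ext n
  rw [coeff_theta, coeff_theta]
  congr 1
  refine card_nbij' (fun x => -x) (fun x => -x) ?_ ?_ (fun x _ => neg_neg x)
    (fun x _ => neg_neg x)
  · intro x hx
    simpa [mem_unaryReps ha] using hx
  · intro x hx
    simpa [mem_unaryReps ha] using hx

/-- The only candidates are `m` and `-m`, and `P` admits at most one of them. -/
lemma coeff_sq_theta_one {P : ℤ → Prop} [DecidablePred P] (hP : ∀ x, P x → ¬ P (-x)) (m : ℕ) :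
    coeff (m ^ 2) (theta P 1) = if P m ∨ P (-m) then 1 else 0 := by
  rw [coeff_theta]
  have hmem (x : ℤ) : x ∈ unaryReps P 1 (m ^ 2) ↔ P x ∧ (x = m ∨ x = -m) := by
    rw [mem_unaryReps one_pos, ← sq_eq_sq_iff_eq_or_eq_neg]
    push_cast
    rw [one_mul]
  split_ifs with h
  · have : #(unaryReps P 1 (m ^ 2)) = 1 := by
      rw [card_eq_one]
      rcases h with h | h
      · refine ⟨m, ?_⟩
        ext x
        rw [hmem, mem_singleton]
        constructor
        · rintro ⟨h1, rfl | rfl⟩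
          · rfl
          · exact absurd h1 (hP _ h)
        · rintro rfl
          exact ⟨h, Or.inl rfl⟩
      · refine ⟨-m, ?_⟩
        ext x
        rw [hmem, mem_singleton]
        constructor
        · rintro ⟨h1, rfl | rfl⟩
          · exact absurd h (hP _ h1)
          · rfl
        · rintro rfl
          exact ⟨h, Or.inr rfl⟩
    rw [this, Nat.cast_one]
  · convert Nat.cast_zero
    rw [card_eq_zero, eq_empty_iff_forall_notMem]
    intro x hx
    rw [hmem] at hx
    obtain ⟨h1, rfl | rfl⟩ := hx
    · exact h (Or.inl h1)
    · exact h (Or.inr h1)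

lemma coeff_theta_one_of_not_isSquare (P : ℤ → Prop) [DecidablePred P] {n : ℕ}
    (hn : ¬ IsSquare n) : coeff n (theta P 1) = 0 := by
  rw [coeff_theta]
  convert Nat.cast_zero
  rw [card_eq_zero, eq_empty_iff_forall_notMem]
  intro x hx
  rw [mem_unaryReps one_pos] at hx
  refine hn ⟨x.natAbs, ?_⟩
  have := hx.2
  zify
  rw [← this, abs_mul_abs_self]
  push_cast
  ring

lemma coeff_Delta (n : ℕ) : coeff n Delta = if Odd n ∧ IsSquare n then 1 else 0 :=
  coeff_mk _ _

/-- For odd `m` exactly one of `m` and `-m` is 1 modulo 4, so the congruence picks one square root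
of each odd square. -/
lemma Delta_eq_theta : Delta = theta (fun x => x % 4 = 1) 1 := by
  ext n
  by_cases hn : IsSquare n
  · obtain ⟨m, rfl⟩ := hn
    rw [← sq, coeff_sq_theta_one (fun x => by omega), coeff_Delta]
    congr 1
    apply propext
    rw [Nat.odd_pow_iff two_ne_zero, Nat.odd_iff, and_iff_left ⟨m, sq m⟩]
    omega
  · rw [coeff_theta_one_of_not_isSquare _ hn, coeff_Delta, if_neg fun h => hn h.2]

lemma expand_Delta {m : ℕ} (hm : m ≠ 0) :
    expand m hm Delta = theta (fun x => x % 4 = 1) m := by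
  rw [Delta_eq_theta, expand_theta _ one_pos, mul_one]

end Theta

/-! ### Frobenius and counting fixed points modulo 2 -/

section Frobenius

lemma sq_eq_expand (f : PowerSeries (ZMod 2)) : f ^ 2 = expand 2 two_ne_zero f := by
  have h := MvPowerSeries.map_frobenius_expand (p := 2) (hp := two_ne_zero) (f := f)
  rw [ZMod.frobenius_zmod, MvPowerSeries.map_id] at h
  exact h.symm

lemma pow_four_eq_expand (f : PowerSeries (ZMod 2)) :
    f ^ 4 = expand 4 four_ne_zero f := by
  rw [show f ^ 4 = (f ^ 2) ^ 2 by ring, sq_eq_expand, sq_eq_expand, ← expand_mul]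

lemma natCast_card_eq_of_involution {α : Type*} [DecidableEq α] (s : Finset α) (i : α → α)
    (hi : ∀ x ∈ s, i x ∈ s) (hii : ∀ x ∈ s, i (i x) = x) :
    (#s : ZMod 2) = #{x ∈ s | i x = x} := by
  rw [← card_filter_add_card_filter_not (s := s) (fun x => i x = x), Nat.cast_add, add_eq_left]
  rw [card_eq_sum_ones, Nat.cast_sum, Nat.cast_one]
  refine sum_involution (fun x _ => i x) (fun _ _ => by decide) ?_ ?_ ?_
  · intro x hx _
    exact (mem_filter.mp hx).2
  · intro x hx
    rw [mem_filter] at hx ⊢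
    refine ⟨hi x hx.1, ?_⟩
    rw [hii x hx.1]
    exact fun h => hx.2 h.symm
  · intro x hx
    exact hii x (mem_filter.mp hx).1

end Frobenius

/-! ### The modular equation of level 3 -/

section LevelThree

/-- The involution of `{(x, y) | x ≡ y ≡ 1 mod 4, x ^ 2 + 3 * y ^ 2 = n}` which comes from
complex conjugation in `ℚ(√-3)`. -/
def involutionThree (z : ℤ × ℤ) : ℤ × ℤ :=
  if (z.1 + z.2) / 2 % 4 = 1 then ((3 * z.2 - z.1) / 2, (z.1 + z.2) / 2)
  else (-((3 * z.2 - z.1) / 2), -((z.1 + z.2) / 2))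

/-- The modular equation of level `3` modulo `2`. -/
lemma Delta_mul_expand_three :
    Delta * expand 3 three_ne_zero Delta = Delta ^ 4 + expand 3 three_ne_zero Delta ^ 4 := by
  rw [pow_four_eq_expand, pow_four_eq_expand, ← expand_mul, expand_Delta, expand_Delta,
    expand_Delta]
  conv_lhs => rw [Delta_eq_theta]
  ext n
  rw [coeff_theta_mul_theta _ _ one_pos three_pos, map_add, coeff_theta, coeff_theta,
    natCast_card_eq_of_involution _ involutionThree, ← Nat.cast_add]
  · congr 1
    -- The fixed points are `(x, x)`, where the form takes the value `4 x ^ 2`, and `(-3 y, y)`,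
    -- where it takes the value `12 y ^ 2`. They account for `Δ ^ 4` and for the fourth power of
    -- `Δ(q ^ 3)`.
    rw [← card_map (s := unaryReps _ 4 n) ⟨fun x : ℤ => (x, x), fun x y h => (Prod.ext_iff.mp h).1⟩,
      ← card_map (s := unaryReps _ (4 * 3) n)
        ⟨fun y : ℤ => (-3 * y, y), fun x y h => (Prod.ext_iff.mp h).2⟩,
      ← card_union_of_disjoint]
    · congr 1
      ext ⟨x, y⟩
      simp only [mem_filter, mem_binaryReps one_pos three_pos, mem_union, mem_map,
        mem_unaryReps four_pos, mem_unaryReps (show 0 < 4 * 3 by norm_num)]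
      constructor
      · rintro ⟨⟨⟨hx, hy⟩, h⟩, hfix⟩
        rw [involutionThree] at hfix
        simp only at hfix
        split_ifs at hfix with h1
        · rw [Prod.mk.injEq] at hfix
          obtain rfl : x = y := by omega
          exact Or.inl ⟨x, ⟨hx, by rw [← h]; push_cast; ring⟩, rfl⟩
        · rw [Prod.mk.injEq] at hfix
          obtain rfl : x = -3 * y := by omega
          exact Or.inr ⟨y, ⟨hy, by rw [← h]; push_cast; ring⟩, rfl⟩
      · rintro (⟨u, ⟨hx, h⟩, hu⟩ | ⟨u, ⟨hy, h⟩, hu⟩)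
        · obtain ⟨rfl, rfl⟩ : u = x ∧ u = y := Prod.ext_iff.mp hu
          refine ⟨⟨⟨hx, hx⟩, by rw [← h]; push_cast; ring⟩, ?_⟩
          rw [involutionThree, if_pos (by simp only; omega), Prod.mk.injEq]
          constructor <;> simp only <;> omega
        · obtain ⟨rfl, rfl⟩ : -3 * u = x ∧ u = y := Prod.ext_iff.mp hu
          refine ⟨⟨⟨by omega, hy⟩, by rw [← h]; push_cast; ring⟩, ?_⟩
          rw [involutionThree, if_neg (by simp only; omega), Prod.mk.injEq]
          constructor <;> simp only <;> omega
    · rw [disjoint_left]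
      rintro ⟨x, y⟩ h1 h2
      simp only [mem_map, mem_unaryReps four_pos, mem_unaryReps (show 0 < 4 * 3 by norm_num)] at h1 h2
      obtain ⟨u, ⟨hu, -⟩, h1⟩ := h1
      obtain ⟨v, -, h2⟩ := h2
      have : u = -3 * v ∧ u = v := Prod.ext_iff.mp (h1.trans h2.symm)
      omega
  · rintro ⟨x, y⟩ h
    rw [mem_binaryReps one_pos three_pos] at h ⊢
    obtain ⟨⟨hx, hy⟩, h⟩ := h
    simp only at hx hy h
    obtain ⟨t, rfl⟩ : ∃ t, x = 2 * t - y := ⟨(x + y) / 2, by omega⟩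
    rw [involutionThree]
    simp only
    rw [show (2 * t - y + y) / 2 = t by omega, show (3 * y - (2 * t - y)) / 2 = 2 * y - t by omega]
    split_ifs
    · refine ⟨⟨by simp only; omega, by simp only; omega⟩, ?_⟩
      rw [← h]; push_cast; ring
    · refine ⟨⟨by simp only; omega, by simp only; omega⟩, ?_⟩
      rw [← h]; push_cast; ring
  · rintro ⟨x, y⟩ h
    rw [mem_binaryReps one_pos three_pos] at h
    obtain ⟨⟨hx, hy⟩, -⟩ := h
    simp only at hx hy
    obtain ⟨t, rfl⟩ : ∃ t, x = 2 * t - y := ⟨(x + y) / 2, by omega⟩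
    rw [involutionThree, involutionThree]
    simp only
    rw [show (2 * t - y + y) / 2 = t by omega, show (3 * y - (2 * t - y)) / 2 = 2 * y - t by omega]
    split_ifs <;> simp only [Prod.mk.injEq] at * <;> omega

end LevelThree

end ModTwoForms

end

noncomputable section

namespace ModTwoForms

open PowerSeries Finset

/-! ### The modular equation of level 5 -/

section LevelFive

instance : CharP (PowerSeries (ZMod 2)) 2 :=
  charP_of_injective_algebraMap (algebraMap (ZMod 2) (PowerSeries (ZMod 2))).injective 2

/-- The theta series `∑ q ^ (x ^ 2)` over `x ≡ 1 mod 6`, the reduction of `η(24 z)`. -/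
def etaSeries : PowerSeries (ZMod 2) := theta (fun x => x % 6 = 1) 1

/-- Odd squares split according to whether their root is divisible by 3; an odd number prime to 3 is
1 modulo 6 for exactly one choice of sign. -/
lemma Delta_eq_etaSeries_add : Delta = etaSeries + expand 9 (by norm_num) Delta := by
  ext n
  rw [map_add, coeff_expand]
  by_cases hn : IsSquare n
  · obtain ⟨m, rfl⟩ := hn
    rw [← sq, etaSeries, coeff_sq_theta_one (fun x => by omega), Delta_eq_theta,
      coeff_sq_theta_one (fun x => by omega)]
    by_cases h3 : 3 ∣ m
    · obtain ⟨m, rfl⟩ := h3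
      rw [show (3 * m) ^ 2 = 9 * m ^ 2 by ring, if_pos (Dvd.intro _ rfl),
        Nat.mul_div_cancel_left _ (by norm_num), coeff_sq_theta_one (fun x => by omega)]
      push_cast
      split_ifs <;> first | (exfalso; omega) | decide
    · rw [if_neg (c := 9 ∣ m ^ 2), add_zero]
      · obtain ⟨k, r, hr, rfl⟩ : ∃ k r, r < 12 ∧ m = 12 * k + r :=
          ⟨m / 12, m % 12, Nat.mod_lt _ (by norm_num), (Nat.div_add_mod m 12).symm⟩
        push_cast
        interval_cases r <;> split_ifs <;> first | (exfalso; omega) | rfl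
      · intro h
        exact h3 (Nat.prime_three.dvd_of_dvd_pow ((by norm_num : 3 ∣ 9).trans h))
  · rw [etaSeries, coeff_theta_one_of_not_isSquare _ hn, coeff_Delta, if_neg fun h => hn h.2]
    split_ifs with h9
    · obtain ⟨k, rfl⟩ := h9
      rw [Nat.mul_div_cancel_left _ (by norm_num), coeff_Delta, if_neg, add_zero]
      rintro ⟨-, j, rfl⟩
      exact hn ⟨3 * j, by ring⟩
    · rw [add_zero]

lemma coeff_one_etaSeries : coeff 1 etaSeries = 1 := by
  have := coeff_sq_theta_one (P := fun x => x % 6 = 1) (fun x => by omega) 1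
  rw [one_pow] at this
  rw [etaSeries, this]
  exact if_pos (Or.inl rfl)

lemma etaSeries_ne_zero : etaSeries ≠ 0 := by
  intro h
  have h1 := coeff_one_etaSeries
  rw [h] at h1
  simp at h1

/-- `η(24 z) ^ 3 = ∑ q ^ (3 x ^ 2)` modulo `2`. -/
lemma etaSeries_pow_three : etaSeries ^ 3 = expand 3 three_ne_zero Delta := by
  have h1 := Delta_mul_expand_three
  have h2 := congrArg (expand 3 three_ne_zero) h1
  rw [map_add, map_mul, map_pow, map_pow, ← expand_mul 3 three_ne_zero 3 three_ne_zero] at h2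
  have h0 := Delta_eq_etaSeries_add
  change expand 3 three_ne_zero Delta * expand 9 (by norm_num) Delta =
    expand 3 three_ne_zero Delta ^ 4 + expand 9 (by norm_num) Delta ^ 4 at h2
  generalize expand 3 three_ne_zero Delta = V at *
  generalize expand 9 _ Delta = W at *
  have hchar : (2 : PowerSeries (ZMod 2)) = 0 := CharTwo.two_eq_zero
  refine mul_left_cancel₀ etaSeries_ne_zero ?_
  rw [h0] at h1
  -- With `E` for `etaSeries`, `V = Δ(q ^ 3)` and `W = Δ(q ^ 9)`, one has `Δ = E + W`. Adding the
  -- level 3 equation to its image under `q ↦ q ^ 3` leaves `E V = E ^ 4` in characteristic 2, and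
  -- `E` cancels.
  linear_combination -h1 - h2 - (2 * etaSeries ^ 3 * W + 3 * etaSeries ^ 2 * W ^ 2 +
    2 * etaSeries * W ^ 3 + W ^ 4 - V * W + V ^ 4) * hchar

/-- An involution of `{(u, v) | u - v ≡ 1 mod 6, u ^ 2 + 5 * v ^ 2 = n}`, which comes from
complex conjugation in `ℚ(√-5)` except on the pairs with all of `u`, `v` prime to `3`. -/
def involutionFive (z : ℤ × ℤ) : ℤ × ℤ :=
  if z.2 % 3 = 0 then (z.1, -z.2)
  else if z.1 % 3 = 0 then (-z.1, z.2)
  else if (z.1 + 7 * z.2) % 9 = 0 then z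
  else if (z.1 + 7 * z.2) / 3 % 6 = 1 then ((2 * z.1 + 5 * z.2) / 3, (z.1 - 2 * z.2) / 3)
  else (-((2 * z.1 + 5 * z.2) / 3), -((z.1 - 2 * z.2) / 3))

lemma involutionFive_of_emod_eq_zero {u v : ℤ} (hv : v % 3 = 0) :
    involutionFive (u, v) = (u, -v) :=
  if_pos hv

lemma involutionFive_of_emod_eq_zero' {u v : ℤ} (hv : v % 3 ≠ 0) (hu : u % 3 = 0) :
    involutionFive (u, v) = (-u, v) :=
  (if_neg hv).trans (if_pos hu)

/-- In the coordinates `a`, `b` all divisions by 3 become exact. The reflection is conjugation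
followed by multiplication by `(2 + √-5) / 3`, of norm one, and a sign. The sign restores the
congruence modulo 6, which is impossible precisely when 9 divides `u + 7 v`; those pairs are left
fixed. -/
lemma involutionFive_apply (a b : ℤ) :
    involutionFive (3 * a + 6 * b + 2, 3 * a + 1) =
      if (8 * a + 2 * b) % 3 = 0 then (3 * a + 6 * b + 2, 3 * a + 1)
      else if (8 * a + 2 * b + 3) % 6 = 1 then (7 * a + 4 * b + 3, 2 * b - a)
      else (-(7 * a + 4 * b + 3), -(2 * b - a)) := by
  rw [involutionFive]
  simp only
  rw [if_neg (by omega), if_neg (by omega),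
    show (3 * a + 6 * b + 2 + 7 * (3 * a + 1)) / 3 = 8 * a + 2 * b + 3 by omega,
    show (2 * (3 * a + 6 * b + 2) + 5 * (3 * a + 1)) / 3 = 7 * a + 4 * b + 3 by omega,
    show (3 * a + 6 * b + 2 - 2 * (3 * a + 1)) / 3 = 2 * b - a by omega]
  congr 1
  apply propext
  omega

lemma exists_eq_of_sub_emod_eq_one {u v : ℤ} (h : (u - v) % 6 = 1) (hv : v % 3 ≠ 0)
    (hu : u % 3 ≠ 0) : ∃ a b, u = 3 * a + 6 * b + 2 ∧ v = 3 * a + 1 :=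
  ⟨v / 3, (u - v) / 6, by omega, by omega⟩

lemma involutionFive_mem {n : ℕ} {z : ℤ × ℤ}
    (hz : z ∈ binaryReps (fun z => (z.1 - z.2) % 6 = 1) 1 5 n) :
    involutionFive z ∈ binaryReps (fun z => (z.1 - z.2) % 6 = 1) 1 5 n := by
  obtain ⟨u, v⟩ := z
  rw [mem_binaryReps one_pos (by norm_num)] at hz ⊢
  obtain ⟨h1, h⟩ := hz
  simp only at h1 h
  by_cases hv : v % 3 = 0
  · rw [involutionFive_of_emod_eq_zero hv]
    exact ⟨by simp only; omega, by rw [← h]; push_cast; ring⟩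
  by_cases hu : u % 3 = 0
  · rw [involutionFive_of_emod_eq_zero' hv hu]
    exact ⟨by simp only; omega, by rw [← h]; push_cast; ring⟩
  obtain ⟨a, b, rfl, rfl⟩ := exists_eq_of_sub_emod_eq_one h1 hv hu
  rw [involutionFive_apply]
  split_ifs with h2 h3
  · exact ⟨h1, h⟩
  · exact ⟨by simp only; omega, by rw [← h]; push_cast; ring⟩
  · have h4 : (4 * a + b) % 3 = 1 := by omega
    obtain ⟨t, rfl⟩ : ∃ t, b = 3 * t + 1 - 4 * a := ⟨(4 * a + b) / 3, by omega⟩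
    exact ⟨by simp only; omega, by rw [← h]; push_cast; ring⟩

lemma involutionFive_involutionFive {z : ℤ × ℤ} (hz : (z.1 - z.2) % 6 = 1) :
    involutionFive (involutionFive z) = z := by
  obtain ⟨u, v⟩ := z
  simp only at hz
  by_cases hv : v % 3 = 0
  · rw [involutionFive_of_emod_eq_zero hv, involutionFive_of_emod_eq_zero (by omega), neg_neg]
  by_cases hu : u % 3 = 0
  · rw [involutionFive_of_emod_eq_zero' hv hu, involutionFive_of_emod_eq_zero' hv (by omega),
      neg_neg]
  obtain ⟨a, b, rfl, rfl⟩ := exists_eq_of_sub_emod_eq_one hz hv hu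
  rw [involutionFive_apply]
  split_ifs with h1 h2
  · rw [involutionFive_apply, if_pos h1]
  · rw [involutionFive]
    simp only
    rw [if_neg (by omega), if_neg (by omega), if_neg (by omega), if_pos (by omega), Prod.mk.injEq]
    omega
  · rw [involutionFive]
    simp only
    rw [if_neg (by omega), if_neg (by omega), if_neg (by omega), if_neg (by omega), Prod.mk.injEq]
    omega

lemma involutionFive_eq_self_iff {z : ℤ × ℤ} (hz : (z.1 - z.2) % 6 = 1) :
    involutionFive z = z ↔ z.2 = 0 ∨ z.1 = 0 ∨
      (z.2 % 3 ≠ 0 ∧ z.1 % 3 ≠ 0 ∧ (z.1 + 7 * z.2) % 9 = 0) := by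
  obtain ⟨u, v⟩ := z
  simp only at hz
  rw [involutionFive]
  simp only
  split_ifs with h2 h3 h4 h5 <;> simp only [Prod.mk.injEq, true_iff, true_and, and_true] <;> omega

/-- The number of representations of `n` as `u ^ 2 + 5 * v ^ 2` with `u - v ≡ 1 mod 6`,
modulo `2`. -/
lemma card_binaryReps_five (n : ℕ) :
    (#(binaryReps (fun z => (z.1 - z.2) % 6 = 1) 1 5 n) : ZMod 2) =
      coeff n (Delta + expand 5 (by norm_num) Delta) := by
  induction n using Nat.strong_induction_on with
  | _ n ih =>
    have hfix : #{z ∈ binaryReps (fun z => (z.1 - z.2) % 6 = 1) 1 5 n | involutionFive z = z} =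
        #(unaryReps (fun x => x % 6 = 1) 1 n) + #(unaryReps (fun x => -x % 6 = 1) 5 n) +
        #{z ∈ binaryReps (fun z => (z.1 - z.2) % 6 = 1) 1 5 n |
          z.2 % 3 ≠ 0 ∧ z.1 % 3 ≠ 0 ∧ (z.1 + 7 * z.2) % 9 = 0} := by
      rw [← card_map (s := unaryReps _ 1 n)
          ⟨fun x : ℤ => (x, (0 : ℤ)), fun x y h => (Prod.ext_iff.mp h).1⟩,
        ← card_map (s := unaryReps _ 5 n)
          ⟨fun y : ℤ => ((0 : ℤ), y), fun x y h => (Prod.ext_iff.mp h).2⟩,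
        ← card_union_of_disjoint, ← card_union_of_disjoint]
      · congr 1
        ext ⟨x, y⟩
        simp only [mem_filter, mem_binaryReps one_pos (show 0 < 5 by norm_num), mem_union, mem_map,
          mem_unaryReps one_pos, mem_unaryReps (show 0 < 5 by norm_num)]
        constructor
        · rintro ⟨⟨h1, h⟩, hf⟩
          rcases (involutionFive_eq_self_iff h1).mp hf with h2 | h2 | h2
          · simp only at h2 h1 h
            subst h2
            exact Or.inl (Or.inl ⟨x, ⟨by omega, by rw [← h]; push_cast; ring⟩, rfl⟩)
          · simp only at h2 h1 h
            subst h2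
            exact Or.inl (Or.inr ⟨y, ⟨by omega, by rw [← h]; push_cast; ring⟩, rfl⟩)
          · exact Or.inr ⟨⟨h1, h⟩, h2⟩
        · rintro ((⟨u, ⟨h1, h⟩, hu⟩ | ⟨u, ⟨h1, h⟩, hu⟩) | ⟨⟨h1, h⟩, h2⟩)
          · obtain ⟨rfl, rfl⟩ : u = x ∧ 0 = y := Prod.ext_iff.mp hu
            refine ⟨⟨by omega, by rw [← h]; push_cast; ring⟩, ?_⟩
            exact (involutionFive_eq_self_iff (by simp only; omega)).mpr (Or.inl rfl)
          · obtain ⟨rfl, rfl⟩ : 0 = x ∧ u = y := Prod.ext_iff.mp hu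
            refine ⟨⟨by omega, by rw [← h]; push_cast; ring⟩, ?_⟩
            exact (involutionFive_eq_self_iff (by simp only; omega)).mpr (Or.inr (Or.inl rfl))
          · exact ⟨⟨h1, h⟩, (involutionFive_eq_self_iff h1).mpr (Or.inr (Or.inr h2))⟩
      · rw [disjoint_left]
        rintro ⟨x, y⟩ h1 h2
        simp only [mem_union, mem_map] at h1
        rw [mem_filter] at h2
        rcases h1 with ⟨u, -, hu⟩ | ⟨u, -, hu⟩
        · obtain ⟨rfl, rfl⟩ : u = x ∧ 0 = y := Prod.ext_iff.mp hu
          exact h2.2.1 rfl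
        · obtain ⟨rfl, rfl⟩ : 0 = x ∧ u = y := Prod.ext_iff.mp hu
          exact h2.2.2.1 rfl
      · rw [disjoint_left]
        rintro ⟨x, y⟩ h1 h2
        rw [mem_map] at h1 h2
        obtain ⟨u, hu, h1⟩ := h1
        obtain ⟨v, hv, h2⟩ := h2
        rw [mem_unaryReps one_pos] at hu
        have : u = 0 ∧ 0 = v := Prod.ext_iff.mp (h1.trans h2.symm)
        omega
    have hbad : (#{z ∈ binaryReps (fun z => (z.1 - z.2) % 6 = 1) 1 5 n |
          z.2 % 3 ≠ 0 ∧ z.1 % 3 ≠ 0 ∧ (z.1 + 7 * z.2) % 9 = 0} : ZMod 2) =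
        coeff n (expand 9 (by norm_num) (Delta + expand 5 (by norm_num) Delta)) := by
      rw [coeff_expand]
      -- For `n = 0` the quotient `n / 9` is not smaller, so induction is unavailable; here both
      -- sides vanish directly.
      rcases Nat.eq_zero_or_pos n with rfl | hn
      · rw [if_pos (dvd_zero 9), Nat.zero_div, map_add, coeff_expand, if_pos (dvd_zero 5),
          Nat.zero_div, CharTwo.add_self_eq_zero]
        convert Nat.cast_zero
        rw [card_eq_zero, eq_empty_iff_forall_notMem]
        rintro ⟨u, v⟩ hz
        rw [mem_filter, mem_binaryReps one_pos (by norm_num)] at hz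
        obtain ⟨⟨-, h⟩, h2, -⟩ := hz
        simp only at h h2
        have : v = 0 := by
          push_cast at h
          nlinarith [sq_nonneg u, sq_nonneg v]
        rw [this] at h2
        exact h2 rfl
      split_ifs with h9
      · obtain ⟨m, rfl⟩ := h9
        rw [Nat.mul_div_cancel_left _ (by norm_num), ← ih m (by omega)]
        congr 1
        -- The exceptional fixed pairs are the multiples of `2 + √-5`, of norm 9: dividing `u + v
        -- √-5` by it yields the pairs counted for `n / 9`.
        refine card_nbij' (fun z => ((2 * z.1 + 5 * z.2) / 9, -((z.1 - 2 * z.2) / 9)))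
          (fun z => (2 * z.1 - 5 * z.2, z.1 + 2 * z.2)) ?_ ?_ ?_ ?_
        · rintro ⟨u, v⟩ hz
          rw [mem_coe, mem_filter, mem_binaryReps one_pos (by norm_num)] at hz
          rw [mem_coe, mem_binaryReps one_pos (by norm_num)]
          obtain ⟨⟨h1, h⟩, h2, h3, h4⟩ := hz
          simp only at h1 h h2 h3 h4 ⊢
          obtain ⟨t, rfl⟩ : ∃ t, u = 9 * t - 7 * v := ⟨(u + 7 * v) / 9, by omega⟩
          rw [show (2 * (9 * t - 7 * v) + 5 * v) / 9 = 2 * t - v by omega,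
            show (9 * t - 7 * v - 2 * v) / 9 = t - v by omega]
          refine ⟨by omega, ?_⟩
          push_cast at h ⊢
          linarith
        · rintro ⟨u, v⟩ hz
          rw [mem_coe, mem_binaryReps one_pos (by norm_num)] at hz
          rw [mem_coe, mem_filter, mem_binaryReps one_pos (by norm_num)]
          obtain ⟨h1, h⟩ := hz
          simp only at h1 h ⊢
          refine ⟨⟨by omega, ?_⟩, by omega, by omega, by omega⟩
          push_cast at h ⊢
          linarith
        · rintro ⟨u, v⟩ hz
          rw [mem_coe, mem_filter, mem_binaryReps one_pos (by norm_num)] at hz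
          obtain ⟨⟨h1, h⟩, h2, h3, h4⟩ := hz
          simp only at h1 h2 h3 h4 ⊢
          rw [Prod.mk.injEq]
          omega
        · rintro ⟨u, v⟩ hz
          simp only
          rw [Prod.mk.injEq]
          omega
      · convert Nat.cast_zero
        rw [card_eq_zero, eq_empty_iff_forall_notMem]
        rintro ⟨u, v⟩ hz
        rw [mem_filter, mem_binaryReps one_pos (by norm_num)] at hz
        obtain ⟨⟨h1, h⟩, h2, h3, h4⟩ := hz
        simp only at h1 h h2 h3 h4
        obtain ⟨t, rfl⟩ : ∃ t, u = 9 * t - 7 * v := ⟨(u + 7 * v) / 9, by omega⟩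
        refine h9 ?_
        have : (9 : ℤ) ∣ n := ⟨9 * t ^ 2 - 14 * t * v + 6 * v ^ 2, by
          rw [← h]; push_cast; ring⟩
        exact_mod_cast this
    rw [natCast_card_eq_of_involution _ involutionFive (fun z => involutionFive_mem)
      (fun z hz => involutionFive_involutionFive
        ((mem_binaryReps one_pos (by norm_num)).mp hz).1), hfix]
    push_cast
    have hneg : theta (fun x => -x % 6 = 1) 5 = theta (fun x => x % 6 = 1) 5 :=
      theta_neg (fun x => x % 6 = 1) (by norm_num)
    rw [hbad, ← coeff_theta, ← coeff_theta, hneg]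
    change coeff n etaSeries + _ + _ = _
    have h5 : theta (fun x => x % 6 = 1) 5 = expand 5 (by norm_num) etaSeries := by
      rw [etaSeries, expand_theta _ one_pos, mul_one]
    have hcomm : expand 5 (by norm_num) (expand 9 (by norm_num) Delta) =
        expand 9 (by norm_num) (expand 5 (by norm_num) Delta) := by
      rw [← expand_mul, ← expand_mul]
    have h0 := Delta_eq_etaSeries_add
    have h1 := congrArg (expand 5 (by norm_num)) h0
    rw [map_add, hcomm] at h1
    have h2 : Delta + expand 5 (by norm_num) Delta = etaSeries + expand 5 (by norm_num) etaSeries +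
        expand 9 (by norm_num) (Delta + expand 5 (by norm_num) Delta) := by
      rw [map_add]
      linear_combination h0 + h1
    rw [h5, ← map_add, ← map_add, ← h2]

/-- The substitution `x = u + 5 v`, `y = u - v` gives `x ^ 2 + 5 y ^ 2 = 6 (u ^ 2 + 5 v ^ 2)`, and
`x ≡ y ≡ 1` modulo 6 becomes `u - v ≡ 1` modulo 6. So the product is the series of
`card_binaryReps_five` in the variable `q ^ 6`. -/
lemma etaSeries_mul_expand_five :
    etaSeries * expand 5 (by norm_num) etaSeries =
      expand 3 three_ne_zero ((Delta + expand 5 (by norm_num) Delta) ^ 2) := by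
  rw [sq_eq_expand, ← expand_mul]
  have h5 : expand 5 (by norm_num) etaSeries = theta (fun x => x % 6 = 1) 5 := by
    rw [etaSeries, expand_theta _ one_pos, mul_one]
  rw [h5, etaSeries]
  ext n
  rw [coeff_theta_mul_theta _ _ one_pos (by norm_num), coeff_expand]
  split_ifs with h6
  · obtain ⟨m, rfl⟩ := h6
    rw [Nat.mul_div_cancel_left _ (by norm_num), ← card_binaryReps_five]
    congr 1
    refine card_nbij' (fun z => ((z.1 + 5 * z.2) / 6, (z.1 - z.2) / 6))
      (fun z => (z.1 + 5 * z.2, z.1 - z.2)) ?_ ?_ ?_ ?_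
    · rintro ⟨x, y⟩ hz
      rw [mem_coe, mem_binaryReps one_pos (by norm_num)] at hz ⊢
      obtain ⟨⟨h1, h2⟩, h⟩ := hz
      simp only at h1 h2 h ⊢
      obtain ⟨t, rfl⟩ : ∃ t, x = 6 * t + y := ⟨(x - y) / 6, by omega⟩
      rw [show (6 * t + y + 5 * y) / 6 = t + y by omega, show (6 * t + y - y) / 6 = t by omega]
      refine ⟨by omega, ?_⟩
      push_cast at h ⊢
      linarith
    · rintro ⟨x, y⟩ hz
      rw [mem_coe, mem_binaryReps one_pos (by norm_num)] at hz ⊢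
      obtain ⟨h1, h⟩ := hz
      simp only at h1 h ⊢
      refine ⟨⟨by omega, by omega⟩, ?_⟩
      push_cast at h ⊢
      linarith
    · rintro ⟨x, y⟩ hz
      rw [mem_coe, mem_binaryReps one_pos (by norm_num)] at hz
      obtain ⟨⟨h1, h2⟩, -⟩ := hz
      simp only at h1 h2 ⊢
      rw [Prod.mk.injEq]
      omega
    · rintro ⟨x, y⟩ hz
      simp only
      rw [Prod.mk.injEq]
      omega
  · convert Nat.cast_zero
    rw [card_eq_zero, eq_empty_iff_forall_notMem]
    rintro ⟨x, y⟩ hz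
    rw [mem_binaryReps one_pos (by norm_num)] at hz
    obtain ⟨⟨h1, h2⟩, h⟩ := hz
    simp only at h1 h2 h
    obtain ⟨t, rfl⟩ : ∃ t, x = 6 * t + y := ⟨(x - y) / 6, by omega⟩
    refine h6 ?_
    have : (6 : ℤ) ∣ n := ⟨6 * t ^ 2 + 2 * t * y + y ^ 2, by rw [← h]; push_cast; ring⟩
    exact_mod_cast this

lemma expand_injective {m : ℕ} (hm : m ≠ 0) :
    Function.Injective (expand m hm : PowerSeries (ZMod 2) →ₐ[ZMod 2] _) := by
  intro f g h
  ext n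
  rw [← coeff_expand_mul m hm, h, coeff_expand_mul]

/-- The modular equation of level `5` modulo `2`. -/
lemma Delta_mul_expand_five :
    Delta * expand 5 (by norm_num) Delta = (Delta + expand 5 (by norm_num) Delta) ^ 6 := by
  -- Cubing the previous identity turns `etaSeries` into `Δ(q ^ 3)`; what results is the desired
  -- equation in the variable `q ^ 3`.
  apply expand_injective three_ne_zero
  have h := congrArg (· ^ 3) etaSeries_mul_expand_five
  simp only [mul_pow, ← map_pow, ← pow_mul, etaSeries_pow_three] at h
  rw [← h, map_mul, ← expand_mul, ← expand_mul]

end LevelFive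

end ModTwoForms

end

noncomputable section

namespace ModTwoForms

open PowerSeries Finset

/-! ### Formal properties of the Hecke operators -/

section HeckeU

/-- The operator `U_p`, sending `∑ a_m q ^ m` to `∑ a_{p m} q ^ m`. -/
def heckeU (p : ℕ) : PowerSeries (ZMod 2) →ₗ[ZMod 2] PowerSeries (ZMod 2) where
  toFun f := PowerSeries.mk fun m => coeff (p * m) f
  map_add' f g := by ext m; simp
  map_smul' c f := by ext m; simp

lemma coeff_heckeU (p m : ℕ) (f : PowerSeries (ZMod 2)) :
    coeff m (heckeU p f) = coeff (p * m) f :=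
  PowerSeries.coeff_mk (R := ZMod 2) m fun m => coeff (p * m) f

lemma coeff_hecke (p m : ℕ) (f : PowerSeries (ZMod 2)) :
    coeff m (hecke p f) = coeff (p * m) f + if p ∣ m then coeff (m / p) f else 0 :=
  PowerSeries.coeff_mk (R := ZMod 2) m fun m =>
    coeff (p * m) f + if p ∣ m then coeff (m / p) f else 0

lemma hecke_eq {p : ℕ} (hp : p ≠ 0) (f : PowerSeries (ZMod 2)) :
    hecke p f = heckeU p f + expand p hp f := by
  ext m
  rw [coeff_hecke, map_add, coeff_heckeU, coeff_expand]

/-- Only exponents divisible by `p` survive, and the first factor has no others. This linearity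
turns a polynomial relation between `Δ` and `Δ(q ^ p)` into a recurrence. -/
lemma heckeU_expand_mul {p : ℕ} (hp : p ≠ 0) (f g : PowerSeries (ZMod 2)) :
    heckeU p (expand p hp f * g) = f * heckeU p g := by
  ext m
  rw [coeff_heckeU, coeff_mul, coeff_mul]
  symm
  refine sum_of_injOn (fun x => (p * x.1, p * x.2)) ?_ ?_ ?_ ?_
  · rintro ⟨a, b⟩ - ⟨c, d⟩ - h
    rw [Prod.mk.injEq] at h ⊢
    exact ⟨Nat.eq_of_mul_eq_mul_left (Nat.pos_of_ne_zero hp) h.1,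
      Nat.eq_of_mul_eq_mul_left (Nat.pos_of_ne_zero hp) h.2⟩
  · rintro ⟨a, b⟩ h
    rw [mem_coe, HasAntidiagonal.mem_antidiagonal] at h ⊢
    simp only at h ⊢
    rw [← mul_add, h]
  · rintro ⟨a, b⟩ h hn
    rw [coeff_expand, if_neg, zero_mul]
    rintro ⟨c, rfl⟩
    rw [HasAntidiagonal.mem_antidiagonal] at h
    obtain ⟨d, rfl⟩ : p ∣ b := (Nat.dvd_add_right (Dvd.intro _ rfl)).mp (h ▸ Dvd.intro m rfl)
    simp only [← mul_add] at h
    exact hn ⟨(c, d), by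
      simpa using Nat.eq_of_mul_eq_mul_left (Nat.pos_of_ne_zero hp) h, rfl⟩
  · rintro ⟨a, b⟩ -
    simp only
    rw [coeff_expand_mul, coeff_heckeU]

lemma heckeU_one {p : ℕ} (hp : p ≠ 0) : heckeU p 1 = 1 := by
  ext m
  rw [coeff_heckeU, coeff_one, coeff_one]
  simp [hp]

lemma hecke_one {p : ℕ} (hp : p ≠ 0) : hecke p 1 = 0 := by
  rw [hecke_eq hp, heckeU_one hp, map_one, CharTwo.add_self_eq_zero]

/-- Squaring is the substitution `q ↦ q ^ 2`, which commutes with `T_p` because 2 and `p` are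
coprime. -/
lemma hecke_sq {p : ℕ} (hp : p.Prime) (hp2 : p ≠ 2) (f : PowerSeries (ZMod 2)) :
    hecke p (f ^ 2) = hecke p f ^ 2 := by
  have hcop : Nat.Coprime 2 p := (Nat.coprime_primes Nat.prime_two hp).mpr hp2.symm
  ext m
  rw [sq_eq_expand, sq_eq_expand, coeff_hecke, coeff_expand, coeff_expand, coeff_expand]
  by_cases h2 : 2 ∣ m
  · obtain ⟨m, rfl⟩ := h2
    rw [if_pos (Dvd.dvd.mul_left (Dvd.intro _ rfl) _), if_pos (Dvd.intro _ rfl),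
      Nat.mul_div_cancel_left _ two_pos, coeff_hecke, mul_left_comm,
      Nat.mul_div_cancel_left _ two_pos]
    congr 1
    by_cases hpm : p ∣ m
    · obtain ⟨m, rfl⟩ := hpm
      rw [mul_left_comm, Nat.mul_div_cancel_left _ hp.pos, Nat.mul_div_cancel_left _ hp.pos,
        if_pos (Dvd.intro _ rfl), if_pos (Dvd.intro _ rfl), if_pos (Dvd.intro _ rfl),
        Nat.mul_div_cancel_left _ two_pos]
    · rw [if_neg hpm, if_neg fun h => hpm (hcop.symm.dvd_of_dvd_mul_left h)]
  · rw [if_neg h2, if_neg fun h => h2 (hcop.dvd_of_dvd_mul_left h), zero_add]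
    split_ifs with hpm h
    · obtain ⟨m, rfl⟩ := hpm
      rw [Nat.mul_div_cancel_left _ hp.pos] at h
      exact absurd (Dvd.dvd.mul_left h p) h2
    · rfl
    · rfl

lemma hecke_Delta {p : ℕ} (hp : p.Prime) (hp2 : p ≠ 2) : hecke p Delta = 0 := by
  ext m
  rw [coeff_hecke, coeff_Delta, coeff_Delta, map_zero]
  have hodd : Odd p := hp.odd_of_ne_two hp2
  have key : (Odd (p * m) ∧ IsSquare (p * m)) ↔ p ∣ m ∧ Odd (m / p) ∧ IsSquare (m / p) := by
    constructor
    · rintro ⟨h1, k, hk⟩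
      have hpk : p ∣ k := by
        have : p ∣ k * k := hk ▸ Dvd.intro _ rfl
        exact (hp.dvd_mul.mp this).elim id id
      obtain ⟨k, rfl⟩ := hpk
      obtain rfl : m = p * (k * k) := Nat.eq_of_mul_eq_mul_left hp.pos (by rw [hk]; ring)
      rw [Nat.mul_div_cancel_left _ hp.pos]
      refine ⟨Dvd.intro _ rfl, ?_, k, rfl⟩
      rw [Nat.odd_mul, Nat.odd_mul] at h1
      exact h1.2.2
    · rintro ⟨⟨m, rfl⟩, h1, k, hk⟩
      rw [Nat.mul_div_cancel_left _ hp.pos] at h1 hk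
      exact ⟨hodd.mul (hodd.mul h1), p * k, by rw [hk]; ring⟩
  by_cases h : p ∣ m
  · rw [if_pos h]
    simp only [key, h, true_and]
    exact CharTwo.add_self_eq_zero _
  · rw [if_neg h, if_neg fun h' => h (key.mp h').1, add_zero]

lemma coeff_self_Delta_pow (k : ℕ) : coeff k (Delta ^ k) = 1 := by
  have h0 : constantCoeff Delta = 0 := by
    rw [← coeff_zero_eq_constantCoeff_apply, coeff_Delta, if_neg (by simp)]
  obtain ⟨u, hu⟩ := X_dvd_iff.mpr h0
  have h1 : coeff 0 u = 1 := by
    rw [← coeff_succ_X_mul, ← hu, coeff_Delta]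
    exact if_pos ⟨odd_one, 1, rfl⟩
  rw [hu, mul_pow, coeff_X_pow_mul', if_pos le_rfl, Nat.sub_self,
    coeff_zero_eq_constantCoeff_apply, map_pow, ← coeff_zero_eq_constantCoeff_apply, h1, one_pow]

lemma hecke_Delta_pow_self_ne_zero {p : ℕ} (hp : p.Prime) : hecke p (Delta ^ p) ≠ 0 := by
  intro h
  have := congrArg (coeff 1) h
  rw [coeff_hecke, mul_one, coeff_self_Delta_pow, if_neg fun h => hp.one_lt.not_ge
    (Nat.le_of_dvd one_pos h), map_zero, add_zero] at this
  exact one_ne_zero this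

end HeckeU

/-! ### Recurrences from the modular equations -/

section Recurrence

/-- The modular equation is symmetric in `Δ` and `Δ(q ^ 3)`, so the `U_3` part and the substitution
part of `T_3` satisfy the same recurrence. -/
lemma hecke_three_Delta_pow_add_four (k : ℕ) :
    hecke 3 (Delta ^ (k + 4)) =
      Delta * hecke 3 (Delta ^ (k + 1)) + Delta ^ 4 * hecke 3 (Delta ^ k) := by
  have h := Delta_mul_expand_three
  have hchar : (2 : PowerSeries (ZMod 2)) = 0 := CharTwo.two_eq_zero
  have hU : heckeU 3 (Delta ^ (k + 4)) =
      Delta * heckeU 3 (Delta ^ (k + 1)) + Delta ^ 4 * heckeU 3 (Delta ^ k) := by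
    rw [← heckeU_expand_mul three_ne_zero, ← heckeU_expand_mul three_ne_zero, ← map_add]
    congr 1
    rw [map_pow]
    linear_combination (-Delta ^ k) * h - Delta ^ k * expand 3 three_ne_zero Delta ^ 4 * hchar
  rw [hecke_eq three_ne_zero, hecke_eq three_ne_zero, hecke_eq three_ne_zero, hU]
  simp only [map_pow]
  generalize expand 3 three_ne_zero Delta = V at *
  linear_combination (-V ^ k) * h - V ^ k * Delta ^ 4 * hchar

/-- The recurrence at `k = 2` reads `y ^ 2 = Δ y` for `y = T_3 (Δ ^ 3)`, because `T_3` commutes with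
squaring and kills `Δ`; and `y` is not zero. -/
lemma hecke_three_Delta_pow_three : hecke 3 (Delta ^ 3) = Delta := by
  have h := hecke_three_Delta_pow_add_four 2
  rw [show 2 + 4 = 3 * 2 from rfl, pow_mul, hecke_sq Nat.prime_three (by norm_num),
    hecke_sq Nat.prime_three (by norm_num), hecke_Delta Nat.prime_three (by norm_num)] at h
  refine mul_left_cancel₀ (hecke_Delta_pow_self_ne_zero Nat.prime_three) ?_
  linear_combination h

lemma hecke_five_Delta_pow_add_six (k : ℕ) :
    hecke 5 (Delta ^ (k + 6)) =
      Delta ^ 2 * hecke 5 (Delta ^ (k + 4)) + Delta ^ 4 * hecke 5 (Delta ^ (k + 2)) +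
        Delta * hecke 5 (Delta ^ (k + 1)) + Delta ^ 6 * hecke 5 (Delta ^ k) := by
  have h := Delta_mul_expand_five
  have hchar : (2 : PowerSeries (ZMod 2)) = 0 := CharTwo.two_eq_zero
  have h' : Delta ^ 6 + Delta ^ 4 * expand 5 (by norm_num) Delta ^ 2 +
      Delta ^ 2 * expand 5 (by norm_num) Delta ^ 4 + expand 5 (by norm_num) Delta ^ 6 +
      Delta * expand 5 (by norm_num) Delta = 0 := by
    generalize expand 5 _ Delta = V at *
    linear_combination -h + (Delta * V - 3 * Delta ^ 5 * V - 7 * Delta ^ 4 * V ^ 2 -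
      10 * Delta ^ 3 * V ^ 3 - 7 * Delta ^ 2 * V ^ 4 - 3 * Delta * V ^ 5) * hchar
  have hU : heckeU 5 (Delta ^ (k + 6)) =
      Delta ^ 2 * heckeU 5 (Delta ^ (k + 4)) + Delta ^ 4 * heckeU 5 (Delta ^ (k + 2)) +
        Delta * heckeU 5 (Delta ^ (k + 1)) + Delta ^ 6 * heckeU 5 (Delta ^ k) := by
    rw [← heckeU_expand_mul (by norm_num), ← heckeU_expand_mul (by norm_num),
      ← heckeU_expand_mul (by norm_num), ← heckeU_expand_mul (by norm_num), ← map_add, ← map_add,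
      ← map_add]
    congr 1
    simp only [map_pow]
    generalize expand 5 _ Delta = V at *
    linear_combination Delta ^ k * h' - Delta ^ k * (Delta ^ 4 * V ^ 2 + Delta ^ 2 * V ^ 4 +
      V ^ 6 + Delta * V) * hchar
  rw [hecke_eq (by norm_num), hecke_eq (by norm_num), hecke_eq (by norm_num),
    hecke_eq (by norm_num), hecke_eq (by norm_num), hU]
  simp only [map_pow]
  generalize expand 5 _ Delta = V at *
  linear_combination V ^ k * h' - V ^ k * (Delta ^ 4 * V ^ 2 + Delta ^ 2 * V ^ 4 +
      Delta ^ 6 + Delta * V) * hchar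

lemma hecke_five_Delta_pow_three : hecke 5 (Delta ^ 3) = 0 := by
  have h := hecke_five_Delta_pow_add_six 0
  rw [show Delta ^ (0 + 6) = (Delta ^ 3) ^ 2 by ring, show Delta ^ (0 + 4) = (Delta ^ 2) ^ 2 by ring,
    show Delta ^ (0 + 2) = Delta ^ 2 by ring, hecke_sq Nat.prime_five (by norm_num),
    hecke_sq Nat.prime_five (by norm_num), hecke_sq Nat.prime_five (by norm_num), pow_zero,
    hecke_one (by norm_num), zero_add, pow_one, hecke_Delta Nat.prime_five (by norm_num)] at h
  exact pow_eq_zero_iff two_ne_zero |>.mp (by linear_combination h)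

lemma hecke_five_Delta_pow_five : hecke 5 (Delta ^ 5) = Delta := by
  have h := hecke_five_Delta_pow_add_six 4
  rw [show Delta ^ (4 + 6) = (Delta ^ 5) ^ 2 by ring,
    show Delta ^ (4 + 4) = ((Delta ^ 2) ^ 2) ^ 2 by ring,
    show Delta ^ (4 + 2) = (Delta ^ 3) ^ 2 by ring, show Delta ^ 4 = (Delta ^ 2) ^ 2 by ring,
    hecke_sq Nat.prime_five (by norm_num), hecke_sq Nat.prime_five (by norm_num),
    hecke_sq Nat.prime_five (by norm_num), hecke_sq Nat.prime_five (by norm_num),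
    hecke_sq Nat.prime_five (by norm_num), hecke_Delta Nat.prime_five (by norm_num),
    hecke_five_Delta_pow_three] at h
  refine mul_left_cancel₀ (hecke_Delta_pow_self_ne_zero Nat.prime_five) ?_
  linear_combination h

end Recurrence

/-! ### Closed formulas by binomial coefficients -/

section ClosedFormula

lemma choose_add_eight (N M : ℕ) :
    ((N + 8).choose M : ZMod 2) = N.choose M + if 8 ≤ M then (N.choose (M - 8) : ZMod 2) else 0 := by
  have h8 : (1 + Polynomial.X : Polynomial (ZMod 2)) ^ 8 = 1 + Polynomial.X ^ 8 := by
    rw [show 8 = 2 ^ 3 from rfl, add_pow_char_pow, one_pow]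
  have h := congrArg (fun f => Polynomial.coeff f M)
    (pow_add (1 + Polynomial.X : Polynomial (ZMod 2)) N 8)
  simp only [h8, mul_add, mul_one, Polynomial.coeff_add, Polynomial.coeff_mul_X_pow',
    Polynomial.coeff_one_add_X_pow] at h
  exact h

lemma hecke_three_Delta_pow (k n : ℕ) (hkn : k ≤ n) :
    hecke 3 (Delta ^ k) = ∑ e ∈ range n,
      ((2 * k + e).choose (4 * e + 3) : ZMod 2) • Delta ^ (k - 1 - e) := by
  induction k using Nat.strong_induction_on generalizing n with
  | _ k ih =>
    have hsmall : k < 3 → ∑ e ∈ range n,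
        ((2 * k + e).choose (4 * e + 3) : ZMod 2) • Delta ^ (k - 1 - e) = 0 := by
      intro hk
      refine sum_eq_zero fun e _ => ?_
      rcases Nat.eq_zero_or_pos e with rfl | he
      · interval_cases k
        · simp
        · simp
        · exact smul_eq_zero_of_left (ZMod.natCast_eq_zero_iff_even.mpr (by decide)) _
      · rw [Nat.choose_eq_zero_of_lt (by omega), Nat.cast_zero, zero_smul]
    match k with
    | 0 => rw [hsmall (by norm_num), pow_zero, hecke_one three_ne_zero]
    | 1 => rw [hsmall (by norm_num), pow_one, hecke_Delta Nat.prime_three (by norm_num)]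
    | 2 => rw [hsmall (by norm_num), hecke_sq Nat.prime_three (by norm_num),
        hecke_Delta Nat.prime_three (by norm_num), sq, zero_mul]
    | 3 =>
      rw [hecke_three_Delta_pow_three, sum_eq_single 1]
      · simp
      · intro e _ he
        rcases Nat.eq_zero_or_pos e with rfl | h0
        · exact smul_eq_zero_of_left (ZMod.natCast_eq_zero_iff_even.mpr (by decide)) _
        · rw [Nat.choose_eq_zero_of_lt (by omega), Nat.cast_zero, zero_smul]
      · intro h
        exact absurd (mem_range.mpr (by omega)) h
    | k + 4 =>
      obtain ⟨n, rfl⟩ : ∃ m, n = m + 2 := ⟨n - 2, by omega⟩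
      rw [hecke_three_Delta_pow_add_four, ih (k + 1) (by omega) n (by omega),
        ih k (by omega) (n + 2) (by omega), mul_sum, mul_sum]
      have hterm (e : ℕ) :
          ((2 * (k + 4) + e).choose (4 * e + 3) : ZMod 2) • Delta ^ (k + 4 - 1 - e) =
          Delta ^ 4 * (((2 * k + e).choose (4 * e + 3) : ZMod 2) • Delta ^ (k - 1 - e)) +
          (if 8 ≤ 4 * e + 3 then ((2 * k + e).choose (4 * e + 3 - 8) : ZMod 2) else 0) •
            Delta ^ (k + 4 - 1 - e) := by
        rw [show 2 * (k + 4) + e = 2 * k + e + 8 by ring, choose_add_eight, add_smul]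
        congr 1
        rw [mul_smul_comm, ← pow_add]
        by_cases he : e < k
        · congr 2
          omega
        · rw [Nat.choose_eq_zero_of_lt (by omega), Nat.cast_zero, zero_smul, zero_smul]
      simp_rw [hterm]
      rw [sum_add_distrib, add_comm]
      congr 1
      -- The terms `e = 0, 1` have `4 e + 3 < 8` and drop out; replacing `e` by `e + 2` in the
      -- others gives the sum for `k + 1`.
      rw [sum_range_succ', sum_range_succ', if_neg (by norm_num), if_neg (by norm_num), zero_smul,
        zero_smul, add_zero, add_zero]
      refine sum_congr rfl fun e _ => ?_
      rw [if_pos (by omega), mul_smul_comm, ← pow_succ', show 2 * k + (e + 1 + 1) = 2 * (k + 1) + e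
        by ring, show 4 * (e + 1 + 1) + 3 - 8 = 4 * e + 3 by omega]
      by_cases he : e ≤ k
      · congr 2
        omega
      · rw [Nat.choose_eq_zero_of_lt (by omega), Nat.cast_zero, zero_smul, zero_smul]

lemma hecke_five_Delta_pow (k n : ℕ) (hkn : k ≤ n) :
    hecke 5 (Delta ^ k) = ∑ e ∈ range n,
      ((4 * k + e).choose (6 * e + 5) : ZMod 2) • Delta ^ (k - 1 - e) := by
  induction k using Nat.strong_induction_on generalizing n with
  | _ k ih =>
    match k with
    | 0 =>
      rw [pow_zero, hecke_one (by norm_num)]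
      refine (sum_eq_zero fun e _ => ?_).symm
      rw [Nat.choose_eq_zero_of_lt (by omega), Nat.cast_zero, zero_smul]
    | 1 =>
      rw [pow_one, hecke_Delta Nat.prime_five (by norm_num)]
      refine (sum_eq_zero fun e _ => ?_).symm
      rw [Nat.choose_eq_zero_of_lt (by omega), Nat.cast_zero, zero_smul]
    | 2 =>
      rw [hecke_sq Nat.prime_five (by norm_num), hecke_Delta Nat.prime_five (by norm_num), sq,
        zero_mul]
      refine (sum_eq_zero fun e _ => ?_).symm
      by_cases he : e < 1
      · interval_cases e
        exact smul_eq_zero_of_left (ZMod.natCast_eq_zero_iff_even.mpr (by decide)) _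
      · rw [Nat.choose_eq_zero_of_lt (by omega), Nat.cast_zero, zero_smul]
    | 3 =>
      rw [hecke_five_Delta_pow_three]
      refine (sum_eq_zero fun e _ => ?_).symm
      by_cases he : e < 2
      · interval_cases e
        · exact smul_eq_zero_of_left (ZMod.natCast_eq_zero_iff_even.mpr (by decide)) _
        · exact smul_eq_zero_of_left (ZMod.natCast_eq_zero_iff_even.mpr (by decide)) _
      · rw [Nat.choose_eq_zero_of_lt (by omega), Nat.cast_zero, zero_smul]
    | 4 =>
      rw [show Delta ^ 4 = (Delta ^ 2) ^ 2 by ring, hecke_sq Nat.prime_five (by norm_num),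
        hecke_sq Nat.prime_five (by norm_num), hecke_Delta Nat.prime_five (by norm_num)]
      rw [sum_eq_zero, sq, sq, zero_mul, zero_mul]
      intro e _
      by_cases he : e < 3
      · interval_cases e
        · exact smul_eq_zero_of_left (ZMod.natCast_eq_zero_iff_even.mpr (by decide)) _
        · exact smul_eq_zero_of_left (ZMod.natCast_eq_zero_iff_even.mpr (by decide)) _
        · exact smul_eq_zero_of_left (ZMod.natCast_eq_zero_iff_even.mpr (by decide)) _
      · rw [Nat.choose_eq_zero_of_lt (by omega), Nat.cast_zero, zero_smul]
    | 5 =>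
      rw [hecke_five_Delta_pow_five, sum_eq_single 3]
      · simp
      · intro e _ he3
        by_cases he : e < 3
        · interval_cases e
          · exact smul_eq_zero_of_left (ZMod.natCast_eq_zero_iff_even.mpr (by decide)) _
          · exact smul_eq_zero_of_left (ZMod.natCast_eq_zero_iff_even.mpr (by decide)) _
          · exact smul_eq_zero_of_left (ZMod.natCast_eq_zero_iff_even.mpr (by decide)) _
        · rw [Nat.choose_eq_zero_of_lt (by omega), Nat.cast_zero, zero_smul]
      · intro h
        exact absurd (mem_range.mpr (by omega)) h
    | k + 6 =>
      obtain ⟨n, rfl⟩ : ∃ m, n = m + 4 := ⟨n - 4, by omega⟩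
      rw [hecke_five_Delta_pow_add_six, ih (k + 4) (by omega) (n + 4) (by omega),
        ih (k + 2) (by omega) (n + 4) (by omega), ih (k + 1) (by omega) n (by omega),
        ih k (by omega) (n + 4) (by omega), mul_sum, mul_sum, mul_sum, mul_sum]
      -- With `y = X ^ 8`, this is `(1 + y) ^ 3 = (1 + y) ^ 2 + (1 + y) + 1 + y ^ 3` modulo 2,
      -- compared coefficientwise after multiplication by `(1 + X) ^ (4 k + e)`.
      have hchoose (e : ℕ) : ((4 * (k + 6) + e).choose (6 * e + 5) : ZMod 2) =
          (4 * (k + 4) + e).choose (6 * e + 5) + (4 * (k + 2) + e).choose (6 * e + 5) +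
          (4 * k + e).choose (6 * e + 5) +
          if 24 ≤ 6 * e + 5 then ((4 * k + e).choose (6 * e + 5 - 24) : ZMod 2) else 0 := by
        rw [show 4 * (k + 6) + e = 4 * k + e + 8 + 8 + 8 by ring,
          show 4 * (k + 4) + e = 4 * k + e + 8 + 8 by ring,
          show 4 * (k + 2) + e = 4 * k + e + 8 by ring]
        simp only [choose_add_eight]
        have h2 : (2 : ZMod 2) = 0 := rfl
        split_ifs <;> first
          | omega
          | (simp only [Nat.sub_sub]
             norm_num
             linear_combination (((4 * k + e).choose (6 * e + 5 - 16) : ZMod 2) -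
               (4 * k + e).choose (6 * e + 5)) * h2)
          | linear_combination (-((4 * k + e).choose (6 * e + 5) : ZMod 2)) * h2
      have hterm (e : ℕ) :
          ((4 * (k + 6) + e).choose (6 * e + 5) : ZMod 2) • Delta ^ (k + 6 - 1 - e) =
          Delta ^ 2 * (((4 * (k + 4) + e).choose (6 * e + 5) : ZMod 2) • Delta ^ (k + 4 - 1 - e)) +
          Delta ^ 4 * (((4 * (k + 2) + e).choose (6 * e + 5) : ZMod 2) • Delta ^ (k + 2 - 1 - e)) +
          Delta ^ 6 * (((4 * k + e).choose (6 * e + 5) : ZMod 2) • Delta ^ (k - 1 - e)) +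
          (if 24 ≤ 6 * e + 5 then ((4 * k + e).choose (6 * e + 5 - 24) : ZMod 2) else 0) •
            Delta ^ (k + 6 - 1 - e) := by
        rw [hchoose, add_smul, add_smul, add_smul, mul_smul_comm, mul_smul_comm, mul_smul_comm,
          ← pow_add, ← pow_add, ← pow_add]
        congr 1
        congr 1
        · congr 1
          · by_cases he : e < k + 4
            · congr 2
              omega
            · rw [Nat.choose_eq_zero_of_lt (by omega), Nat.cast_zero, zero_smul, zero_smul]
          · by_cases he : e < k + 2
            · congr 2
              omega
            · rw [Nat.choose_eq_zero_of_lt (by omega), Nat.cast_zero, zero_smul, zero_smul]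
        · by_cases he : e < k
          · congr 2
            omega
          · rw [Nat.choose_eq_zero_of_lt (by omega), Nat.cast_zero, zero_smul, zero_smul]
      simp_rw [hterm]
      rw [sum_add_distrib, sum_add_distrib, sum_add_distrib, add_assoc, add_assoc (_ + _)]
      congr 1
      rw [add_comm]
      congr 1
      rw [sum_range_succ', sum_range_succ', sum_range_succ', sum_range_succ', if_neg (by norm_num),
        if_neg (by norm_num), if_neg (by norm_num), if_neg (by norm_num), zero_smul, zero_smul,
        zero_smul, zero_smul, add_zero, add_zero, add_zero, add_zero]
      refine sum_congr rfl fun e _ => ?_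
      rw [if_pos (by omega), mul_smul_comm, ← pow_succ', show 4 * k + (e + 1 + 1 + 1 + 1) =
        4 * (k + 1) + e by ring, show 6 * (e + 1 + 1 + 1 + 1) + 5 - 24 = 6 * e + 5 by omega]
      by_cases he : e ≤ k
      · congr 2
        omega
      · rw [Nat.choose_eq_zero_of_lt (by omega), Nat.cast_zero, zero_smul, zero_smul]

end ClosedFormula

end ModTwoForms

end

noncomputable section

namespace ModTwoForms

open PowerSeries Finset

/-! ### From power series in `q` to polynomials in `t` -/

section Transport

/-- The linear map `𝔽₂[t] → 𝔽₂[[q]]` sending `t ^ c` to `Δ ^ (2 c + 1)`. -/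
def oddPowers : Polynomial (ZMod 2) →ₗ[ZMod 2] PowerSeries (ZMod 2) :=
  LinearMap.mulLeft (ZMod 2) Delta ∘ₗ (Polynomial.aeval (Delta ^ 2)).toLinearMap

lemma oddPowers_X_pow (c : ℕ) : oddPowers (Polynomial.X ^ c) = Delta ^ (2 * c + 1) := by
  simp only [oddPowers, LinearMap.coe_comp, Function.comp_apply, AlgHom.toLinearMap_apply, map_pow,
    Polynomial.aeval_X, LinearMap.mulLeft_apply]
  rw [← pow_mul, ← pow_succ']

lemma sum_range_four_mul {M : Type*} [AddCommMonoid M] (f : ℕ → M) (n : ℕ) :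
    ∑ e ∈ range (4 * n), f e =
      ∑ g ∈ range n, (f (4 * g) + f (4 * g + 1) + f (4 * g + 2) + f (4 * g + 3)) := by
  induction n with
  | zero => rfl
  | succ n ih =>
    rw [mul_add, mul_one, sum_range_succ, sum_range_succ, sum_range_succ, sum_range_succ, ih,
      sum_range_succ]
    simp only [add_assoc]

lemma sum_range_four_mul_eq {M : Type*} [AddCommMonoid M] (f : ℕ → M) (n : ℕ)
    (hf : ∀ e, e % 4 ≠ 1 → f e = 0) :
    ∑ e ∈ range (4 * n), f e = ∑ g ∈ range n, f (4 * g + 1) := by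
  rw [sum_range_four_mul]
  refine sum_congr rfl fun g _ => ?_
  rw [hf (4 * g) (by omega), hf (4 * g + 2) (by omega), hf (4 * g + 3) (by omega), zero_add,
    add_zero, add_zero]

lemma sum_range_eight_mul_eq {M : Type*} [AddCommMonoid M] (f : ℕ → M) (n : ℕ)
    (hf : ∀ e, e % 8 ≠ 3 → f e = 0) :
    ∑ e ∈ range (8 * n), f e = ∑ g ∈ range n, f (8 * g + 3) := by
  induction n with
  | zero => rfl
  | succ n ih =>
    rw [mul_add, mul_one, sum_range_succ, sum_range_succ, sum_range_succ, sum_range_succ,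
      sum_range_succ, sum_range_succ, sum_range_succ, sum_range_succ, ih, sum_range_succ,
      hf (8 * n) (by omega), hf (8 * n + 1) (by omega), hf (8 * n + 2) (by omega),
      hf (8 * n + 4) (by omega), hf (8 * n + 5) (by omega), hf (8 * n + 6) (by omega),
      hf (8 * n + 7) (by omega)]
    simp only [add_zero]

lemma natCast_zmod_two_eq_of_odd_iff {a b : ℕ} (h : Odd a ↔ Odd b) : (a : ZMod 2) = b := by
  classical
  rw [natCast_zmod_two_eq_ite, natCast_zmod_two_eq_ite, if_congr h rfl rfl]

lemma oddPowers_binomialOp_X_pow (B s c : ℕ) :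
    oddPowers (binomialOp B s (Polynomial.X ^ c)) = ∑ g ∈ range (c + 1),
      ((c + g).choose ((B + 2) * g + s) : ZMod 2) • Delta ^ (2 * (c - (B * g + s)) + 1) := by
  rw [binomialOp_X_pow, map_sum]
  refine sum_congr rfl fun g _ => ?_
  rw [← Polynomial.C_eq_natCast, ← Polynomial.smul_eq_C_mul, map_smul, oddPowers_X_pow]

/-- In the closed formula the lower index is 3 modulo 4, so by Lucas the upper one, `4 c + 2 + e`,
must be too. Only `e = 4 g + 1` survives, and removing the last base 4 digit leaves the binomial of
`binomialOp 2 1`. -/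
lemma hecke_three_odd_pow (c : ℕ) :
    hecke 3 (Delta ^ (2 * c + 1)) = oddPowers (binomialOp 2 1 (Polynomial.X ^ c)) := by
  rw [hecke_three_Delta_pow _ (4 * (c + 1)) (by omega), sum_range_four_mul_eq,
    oddPowers_binomialOp_X_pow]
  · refine sum_congr rfl fun g _ => ?_
    have h : ((2 * (2 * c + 1) + (4 * g + 1)).choose (4 * (4 * g + 1) + 3) : ZMod 2) =
        (c + g).choose ((2 + 2) * g + 1) := by
      apply natCast_zmod_two_eq_of_odd_iff
      rw [show 2 * (2 * c + 1) + (4 * g + 1) = 4 * (c + g) + 3 by ring,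
        odd_choose_four_mul_add (by norm_num) (by norm_num)]
      simp
    rw [h]
    by_cases hle : 2 * g + 1 ≤ c
    · congr 2
      omega
    · rw [Nat.choose_eq_zero_of_lt (by omega), Nat.cast_zero, zero_smul, zero_smul]
  · intro e he
    refine smul_eq_zero_of_left (ZMod.natCast_eq_zero_iff_even.mpr ?_) _
    rw [← Nat.not_odd_iff_even]
    intro h
    obtain ⟨e, r, hr, rfl⟩ : ∃ e' r, r < 4 ∧ e = 4 * e' + r := ⟨e / 4, e % 4, by omega, by omega⟩
    rw [show 2 * (2 * c + 1) + (4 * e + r) = 4 * (c + e + (r + 2) / 4) + (r + 2) % 4 by omega,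
      odd_choose_four_mul_add (by omega) (by norm_num)] at h
    have h1 := h.1
    rw [Nat.choose_eq_zero_of_lt (by omega)] at h1
    simp at h1

/-- The same sieve modulo 8 leaves only `e = 8 g + 3`. -/
lemma hecke_five_odd_pow (c : ℕ) :
    hecke 5 (Delta ^ (2 * c + 1)) = oddPowers (binomialOp 4 2 (Polynomial.X ^ c)) := by
  rw [hecke_five_Delta_pow _ (8 * (c + 1)) (by omega), sum_range_eight_mul_eq,
    oddPowers_binomialOp_X_pow]
  · refine sum_congr rfl fun g _ => ?_
    have h : ((4 * (2 * c + 1) + (8 * g + 3)).choose (6 * (8 * g + 3) + 5) : ZMod 2) =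
        (c + g).choose ((4 + 2) * g + 2) := by
      apply natCast_zmod_two_eq_of_odd_iff
      rw [show 4 * (2 * c + 1) + (8 * g + 3) = 8 * (c + g) + 7 by ring,
        show 6 * (8 * g + 3) + 5 = 8 * (6 * g + 2) + 7 by ring,
        odd_choose_eight_mul_add (by norm_num) (by norm_num)]
      simp
    rw [h]
    by_cases hle : 4 * g + 2 ≤ c
    · congr 2
      omega
    · rw [Nat.choose_eq_zero_of_lt (by omega), Nat.cast_zero, zero_smul, zero_smul]
  · intro e he
    refine smul_eq_zero_of_left (ZMod.natCast_eq_zero_iff_even.mpr ?_) _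
    rw [← Nat.not_odd_iff_even]
    intro h
    obtain ⟨e, r, hr, rfl⟩ : ∃ e' r, r < 8 ∧ e = 8 * e' + r := ⟨e / 8, e % 8, by omega, by omega⟩
    rw [show 4 * (2 * c + 1) + (8 * e + r) = 8 * (c + e + (r + 4) / 8) + (r + 4) % 8 by omega,
      show 6 * (8 * e + r) + 5 = 8 * (6 * e + (6 * r + 5) / 8) + (6 * r + 5) % 8 by omega,
      odd_choose_eight_mul_add (by omega) (by omega)] at h
    have h1 := h.1
    have hr3 : r ≠ 3 := by omega
    revert h1
    clear h he
    interval_cases r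
    all_goals first | exact absurd rfl hr3 | decide

lemma hecke_three_oddPowers (f : Polynomial (ZMod 2)) :
    hecke 3 (oddPowers f) = oddPowers (binomialOp 2 1 f) := by
  conv in f => rw [f.as_sum_support_C_mul_X_pow]
  conv_rhs => rw [f.as_sum_support_C_mul_X_pow]
  simp only [map_sum, ← Polynomial.smul_eq_C_mul, map_smul, oddPowers_X_pow, hecke_three_odd_pow]

lemma hecke_five_oddPowers (f : Polynomial (ZMod 2)) :
    hecke 5 (oddPowers f) = oddPowers (binomialOp 4 2 f) := by
  conv in f => rw [f.as_sum_support_C_mul_X_pow]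
  conv_rhs => rw [f.as_sum_support_C_mul_X_pow]
  simp only [map_sum, ← Polynomial.smul_eq_C_mul, map_smul, oddPowers_X_pow, hecke_five_odd_pow]

lemma coeff_Delta_pow_of_lt {k m : ℕ} (h : m < k) : coeff m (Delta ^ k) = 0 := by
  have h0 : constantCoeff Delta = 0 := by
    rw [← coeff_zero_eq_constantCoeff_apply, coeff_Delta, if_neg (by simp)]
  obtain ⟨u, hu⟩ := X_dvd_iff.mpr h0
  rw [hu, mul_pow, coeff_X_pow_mul', if_neg (by omega)]

/-- `Δ ^ k` begins with `q ^ k`, so the lowest term of the polynomial cannot be cancelled. -/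
lemma oddPowers_injective : Function.Injective oddPowers := by
  rw [← LinearMap.ker_eq_bot, LinearMap.ker_eq_bot']
  intro f hf
  by_contra hne
  have h := congrArg (coeff (2 * f.natTrailingDegree + 1)) hf
  conv at h in oddPowers f => rw [f.as_sum_support_C_mul_X_pow]
  simp only [map_sum, ← Polynomial.smul_eq_C_mul, map_smul, oddPowers_X_pow, map_zero] at h
  rw [sum_eq_single f.natTrailingDegree, coeff_self_Delta_pow, smul_eq_mul, mul_one] at h
  · exact hne (Polynomial.trailingCoeff_eq_zero.mp h)
  · intro c hc hne'
    have := Polynomial.natTrailingDegree_le_of_mem_supp c hc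
    rw [coeff_Delta_pow_of_lt (by omega), smul_zero]
  · intro h
    rw [Polynomial.notMem_support_iff.mp h, zero_smul]

lemma F_eq_map_degreeLT (n : ℕ) : F n = (Polynomial.degreeLT (ZMod 2) n).map oddPowers := by
  rw [Polynomial.degreeLT_eq_span_X_pow, Submodule.map_span, F]
  congr 1
  ext f
  simp only [Set.mem_range, coe_image, coe_range, Set.mem_image, Set.mem_Iio,
    exists_exists_and_eq_and, oddPowers_X_pow]
  exact ⟨fun ⟨i, hi⟩ => ⟨i, i.2, hi⟩, fun ⟨c, hc, hf⟩ => ⟨⟨c, hc⟩, hf⟩⟩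

/-- The joint kernel of `T_3` and `T_5` is spanned by `Δ`. -/
lemma eq_smul_Delta_of_hecke_eq_zero {n : ℕ} {f : PowerSeries (ZMod 2)} (hf : f ∈ F n)
    (h3 : hecke 3 f = 0) (h5 : hecke 5 f = 0) : f = coeff 1 f • Delta := by
  rw [F_eq_map_degreeLT] at hf
  obtain ⟨g, -, rfl⟩ := hf
  rw [hecke_three_oddPowers, map_eq_zero_iff _ oddPowers_injective] at h3
  rw [hecke_five_oddPowers, map_eq_zero_iff _ oddPowers_injective] at h5
  have hg : oddPowers g = g.coeff 0 • Delta := by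
    conv_lhs => rw [eq_C_of_binomialOp_eq_zero h3 h5, ← mul_one (Polynomial.C _),
      ← Polynomial.smul_eq_C_mul, map_smul, ← pow_zero Polynomial.X, oddPowers_X_pow, mul_zero,
      zero_add, pow_one]
  have h1 : coeff 1 Delta = 1 := by
    rw [coeff_Delta]
    exact if_pos ⟨odd_one, 1, rfl⟩
  rw [hg, map_smul, h1, smul_eq_mul, mul_one]

lemma hecke_three_mem_F {n : ℕ} {f : PowerSeries (ZMod 2)} (hf : f ∈ F (n + 1)) :
    hecke 3 f ∈ F n := by
  rw [F_eq_map_degreeLT] at hf ⊢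
  obtain ⟨g, hg, rfl⟩ := hf
  rw [hecke_three_oddPowers]
  exact Submodule.mem_map_of_mem (binomialOp_mem_degreeLT one_pos hg)

lemma hecke_five_mem_F {n : ℕ} {f : PowerSeries (ZMod 2)} (hf : f ∈ F (n + 1)) :
    hecke 5 f ∈ F n := by
  rw [F_eq_map_degreeLT] at hf ⊢
  obtain ⟨g, hg, rfl⟩ := hf
  rw [hecke_five_oddPowers]
  exact Submodule.mem_map_of_mem (binomialOp_mem_degreeLT two_pos hg)

end Transport

/-! ### Commutation of Hecke operators -/

section Commute

lemma hecke_comm {p l : ℕ} (hp : p.Prime) (hl : l.Prime) (f : PowerSeries (ZMod 2)) :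
    hecke p (hecke l f) = hecke l (hecke p f) := by
  rcases eq_or_ne p l with rfl | hne
  · rfl
  have hcop : Nat.Coprime p l := (Nat.coprime_primes hp hl).mpr hne
  ext m
  simp only [coeff_hecke]
  have h1 : l ∣ p * m ↔ l ∣ m := hcop.symm.dvd_mul_left
  have h2 : p ∣ l * m ↔ p ∣ m := hcop.dvd_mul_left
  have h3 : p ∣ m → l ∣ m → m / p / l = m / l / p := fun _ _ => by
    rw [Nat.div_div_eq_div_mul, Nat.div_div_eq_div_mul, mul_comm]
  have h4 : p ∣ m → (l ∣ m / p ↔ l ∣ m) := by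
    rintro ⟨k, rfl⟩
    rw [Nat.mul_div_cancel_left _ hp.pos, hcop.symm.dvd_mul_left]
  have h5 : l ∣ m → (p ∣ m / l ↔ p ∣ m) := by
    rintro ⟨k, rfl⟩
    rw [Nat.mul_div_cancel_left _ hl.pos, hcop.dvd_mul_left]
  have h6 : p ∣ m → l * (m / p) = l * m / p := fun h => (Nat.mul_div_assoc l h).symm
  have h7 : l ∣ m → p * (m / l) = p * m / l := fun h => (Nat.mul_div_assoc p h).symm
  simp only [h1, h2]
  by_cases hpm : p ∣ m <;> by_cases hlm : l ∣ m
  · simp only [hpm, hlm, h4 hpm, h5 hlm, h6 hpm, h7 hlm, h3 hpm hlm, if_true, mul_left_comm p l m]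
    ring
  · simp only [hpm, hlm, h4 hpm, h6 hpm, if_true, if_false, mul_left_comm p l m]
    ring
  · simp only [hpm, hlm, h5 hlm, h7 hlm, if_true, if_false, mul_left_comm p l m]
    ring
  · simp only [hpm, hlm, if_false, mul_left_comm p l m]

end Commute

end ModTwoForms

end

noncomputable section

namespace ModTwoForms

open PowerSeries Finset

/-! ### Duality and generation by `T_3` and `T_5` -/

section HeckeAlgebra

variable {n : ℕ}

/-- The subalgebra of `A n` generated by `T_3` and `T_5`. -/
def adjoinThreeFive (h : HeckeStable n) : Subalgebra (ZMod 2) (Module.End (ZMod 2) (F n)) :=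
  Algebra.adjoin (ZMod 2)
    {T h 3 Nat.prime_three (by norm_num), T h 5 Nat.prime_five (by norm_num)}

lemma T_three_mem (h : HeckeStable n) :
    T h 3 Nat.prime_three (by norm_num) ∈ adjoinThreeFive h :=
  Algebra.subset_adjoin (Set.mem_insert _ _)

lemma T_five_mem (h : HeckeStable n) :
    T h 5 Nat.prime_five (by norm_num) ∈ adjoinThreeFive h :=
  Algebra.subset_adjoin (Set.mem_insert_of_mem _ rfl)

lemma T_commute (h : HeckeStable n) {p l : ℕ} (hp : p.Prime) (hp2 : p ≠ 2) (hl : l.Prime)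
    (hl2 : l ≠ 2) : Commute (T h p hp hp2) (T h l hl hl2) :=
  LinearMap.ext fun v => Subtype.ext (hecke_comm hp hl v)

lemma commute_of_mem_adjoinThreeFive (h : HeckeStable n) {u : Module.End (ZMod 2) (F n)}
    (h3 : Commute u (T h 3 Nat.prime_three (by norm_num)))
    (h5 : Commute u (T h 5 Nat.prime_five (by norm_num)))
    {w : Module.End (ZMod 2) (F n)} (hw : w ∈ adjoinThreeFive h) : Commute u w := by
  have hle : adjoinThreeFive h ≤ Subalgebra.centralizer (ZMod 2) {u} := by
    refine Algebra.adjoin_le ?_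
    rintro x (rfl | rfl)
    · rintro y rfl
      exact h3
    · rintro y rfl
      exact h5
  exact hle hw u rfl

lemma commute_of_mem_of_mem (h : HeckeStable n) {u w : Module.End (ZMod 2) (F n)}
    (hu : u ∈ adjoinThreeFive h) (hw : w ∈ adjoinThreeFive h) : Commute u w :=
  commute_of_mem_adjoinThreeFive h
    (commute_of_mem_adjoinThreeFive h (T_commute h _ _ _ _) (T_commute h _ _ _ _) hu).symm
    (commute_of_mem_adjoinThreeFive h (T_commute h _ _ _ _) (T_commute h _ _ _ _) hu).symm hw

/-- The linear form `f ↦ a_1(f)`. -/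
def firstCoeff (n : ℕ) : F n →ₗ[ZMod 2] ZMod 2 :=
  (coeff 1 : PowerSeries (ZMod 2) →ₗ[ZMod 2] ZMod 2) ∘ₗ (F n).subtype

/-- Induction on a filtration level `m` with `v` in `F m`: `T_3 v` and `T_5 v` lie one level lower
and inherit the hypothesis, so both vanish. Then `v` is a multiple of `Δ`, with factor `a_1 (v) =
0`. -/
lemma eq_zero_of_firstCoeff_eq_zero (h : HeckeStable n) (v : F n)
    (hv : ∀ u ∈ adjoinThreeFive h, firstCoeff n (u v) = 0) : v = 0 := by
  suffices H : ∀ m : ℕ, ∀ v : F n, (v : PowerSeries (ZMod 2)) ∈ F m →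
      (∀ u ∈ adjoinThreeFive h, firstCoeff n (u v) = 0) → v = 0 from H n v v.2 hv
  intro m
  induction m with
  | zero =>
    intro v hm _
    rw [F, Set.range_eq_empty, Submodule.span_empty, Submodule.mem_bot] at hm
    exact Subtype.ext hm
  | succ m ih =>
    intro v hm hv
    have h3 := ih (T h 3 Nat.prime_three (by norm_num) v) (hecke_three_mem_F hm)
      fun u hu => hv _ (mul_mem hu (T_three_mem h))
    have h5 := ih (T h 5 Nat.prime_five (by norm_num) v) (hecke_five_mem_F hm)
      fun u hu => hv _ (mul_mem hu (T_five_mem h))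
    have hv1 : coeff 1 (v : PowerSeries (ZMod 2)) = 0 := hv 1 (one_mem _)
    refine Subtype.ext ?_
    rw [eq_smul_Delta_of_hecke_eq_zero v.2 (congrArg Subtype.val h3) (congrArg Subtype.val h5), hv1,
      zero_smul]
    rfl

instance : FiniteDimensional (ZMod 2) (F n) :=
  FiniteDimensional.span_of_finite _ (Set.finite_range _)

/-- The preceding lemma says that these forms have no common zero other than 0; in finite dimension
they therefore fill the dual. -/
lemma exists_firstCoeff_comp_eq (h : HeckeStable n) (φ : Module.Dual (ZMod 2) (F n)) :
    ∃ u ∈ adjoinThreeFive h, firstCoeff n ∘ₗ u = φ := by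
  let W : Submodule (ZMod 2) (Module.Dual (ZMod 2) (F n)) :=
    (Subalgebra.toSubmodule (adjoinThreeFive h)).map
      (LinearMap.compRight (ZMod 2) (firstCoeff n) (M := F n))
  have hW : W = ⊤ := by
    have hco : W.dualCoannihilator = ⊥ := by
      rw [eq_bot_iff]
      intro v hv
      rw [Submodule.mem_dualCoannihilator] at hv
      exact eq_zero_of_firstCoeff_eq_zero h v fun u hu => hv _ (Submodule.mem_map_of_mem hu)
    rw [← Subspace.dualCoannihilator_dualAnnihilator_eq (W := W), hco,
      Submodule.dualAnnihilator_bot]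
  have hφ : φ ∈ W := hW ▸ Submodule.mem_top
  obtain ⟨u, hu, rfl⟩ := hφ
  exact ⟨u, hu, rfl⟩

lemma T_mem_adjoinThreeFive (h : HeckeStable n) {p : ℕ} (hp : p.Prime) (hp2 : p ≠ 2) :
    T h p hp hp2 ∈ adjoinThreeFive h := by
  obtain ⟨u, hu, hφ⟩ := exists_firstCoeff_comp_eq h (firstCoeff n ∘ₗ T h p hp hp2)
  suffices T h p hp hp2 = u from this ▸ hu
  ext1 v
  rw [← sub_eq_zero]
  refine eq_zero_of_firstCoeff_eq_zero h _ fun w hw => ?_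
  have h1 : Commute (T h p hp hp2) w :=
    commute_of_mem_adjoinThreeFive h (T_commute h _ _ _ _) (T_commute h _ _ _ _) hw
  have h2 : Commute u w := commute_of_mem_of_mem h hu hw
  have e1 : w (T h p hp hp2 v) = T h p hp hp2 (w v) := (LinearMap.congr_fun h1.eq v).symm
  have e2 : w (u v) = u (w v) := (LinearMap.congr_fun h2.eq v).symm
  rw [map_sub, map_sub, e1, e2, sub_eq_zero]
  exact (LinearMap.congr_fun hφ (w v)).symm

lemma A_eq_adjoinThreeFive (h : HeckeStable n) : A h = adjoinThreeFive h := by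
  apply le_antisymm
  · refine Algebra.adjoin_le ?_
    rintro u ⟨p, hp, hp2, rfl⟩
    exact T_mem_adjoinThreeFive h hp hp2
  · refine Algebra.adjoin_mono ?_
    rintro u (rfl | rfl)
    · exact ⟨3, Nat.prime_three, by norm_num, rfl⟩
    · exact ⟨5, Nat.prime_five, by norm_num, rfl⟩

end HeckeAlgebra

end ModTwoForms

end

noncomputable section

namespace ModTwoForms

open UpperHalfPlane hiding I
open ModularForm Complex MatrixGroups Filter

/-! ### Hecke operators on complex level one forms -/

section LevelOneHecke

variable {w : ℕ}

/-- The values of a level one form under a general unimodular substitution. -/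
theorem levelOne_apply_moebius (f : ModularForm 𝒮ℒ (w : ℤ)) {a b c d : ℤ} (h : a * d - b * c = 1)
    {z z' : ℂ} (hz : 0 < z.im) (hz' : z' = (a * z + b) / (c * z + d)) :
    f (ofComplex z') = (c * z + d) ^ w * f (ofComplex z) := by
  let γ : SL(2, ℤ) := ⟨!![a, b; c, d], by rw [Matrix.det_fin_two_of, h]⟩
  have hcoe : ((γ • (⟨z, hz⟩ : ℍ) : ℍ) : ℂ) = z' := by
    rw [coe_specialLinearGroup_apply, hz']
    simp [γ]
  have hf := SlashInvariantForm.slash_action_eqn' f (γ := Matrix.SpecialLinearGroup.mapGL ℝ γ)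
    (MonoidHom.mem_range.2 ⟨γ, rfl⟩) ⟨z, hz⟩
  rw [← hcoe, ofComplex_apply, ofComplex_apply_of_im_pos hz]
  refine hf.trans ?_
  have hc : ((Matrix.SpecialLinearGroup.mapGL ℝ γ : GL (Fin 2) ℝ) 1 0 : ℝ) = c := by
    change algebraMap ℤ ℝ (γ 1 0) = c
    simp [γ]
  have hd : ((Matrix.SpecialLinearGroup.mapGL ℝ γ : GL (Fin 2) ℝ) 1 1 : ℝ) = d := by
    change algebraMap ℤ ℝ (γ 1 1) = d
    simp [γ]
  rw [hc, hd]
  simp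

theorem levelOne_apply_add_int (f : ModularForm 𝒮ℒ (w : ℤ)) {z : ℂ} (hz : 0 < z.im) (n : ℤ) :
    f (ofComplex (z + n)) = f (ofComplex z) := by
  rw [levelOne_apply_moebius f (a := 1) (b := n) (c := 0) (d := 1) (by ring) hz (by simp)]
  simp

theorem differentiableOn_levelOne (f : ModularForm 𝒮ℒ (w : ℤ)) :
    DifferentiableOn ℂ (fun z => f (ofComplex z)) {z | 0 < z.im} :=
  UpperHalfPlane.mdifferentiable_iff.1 f.holo'

theorem hasSum_levelOne (f : ModularForm 𝒮ℒ (w : ℤ)) {z : ℂ} (hz : 0 < z.im) :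
    HasSum (fun m : ℕ => (qExpansion 1 f).coeff m * exp (2 * Real.pi * I * z * m))
      (f (ofComplex z)) := by
  have : Fact (IsCusp OnePoint.infty 𝒮ℒ) :=
    ⟨Subgroup.isCusp_of_mem_strictPeriods one_pos one_mem_strictPeriods_SL⟩
  convert ModularForm.hasSum_qExpansion f one_pos one_mem_strictPeriods_SL ⟨z, hz⟩ using 1
  · funext m
    rw [Function.Periodic.qParam, ← Complex.exp_nat_mul]
    congr 2
    simp
    ring
  · rw [ofComplex_apply_of_im_pos hz]

/-- `p` times the classical Hecke operator `T_p` in weight `w`, as an operator on functions. -/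
def heckeFun (p w : ℕ) (f : ℍ → ℂ) (τ : ℍ) : ℂ :=
  p ^ w * f (ofComplex (p * τ)) + ∑ i ∈ Finset.range p, f (ofComplex ((τ + i) / p))

theorem im_natCast_mul_pos {p : ℕ} (hp : 0 < p) {z : ℂ} (hz : 0 < z.im) :
    0 < ((p : ℂ) * z).im := by
  simp only [mul_im, natCast_re, natCast_im, zero_mul, add_zero]
  positivity

theorem im_add_div_natCast_pos {p : ℕ} (hp : 0 < p) {z : ℂ} (hz : 0 < z.im) (i : ℕ) :
    0 < ((z + i) / p).im := by
  rw [div_natCast_im, add_im, natCast_im, add_zero]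
  positivity

theorem heckeFun_slash_T {p : ℕ} (hp : 0 < p) (f : ModularForm 𝒮ℒ (w : ℤ)) :
    heckeFun p w f ∣[(w : ℤ)] ModularGroup.T = heckeFun p w f := by
  ext τ
  have hp0 : (p : ℂ) ≠ 0 := by exact_mod_cast hp.ne'
  have key : heckeFun p w f (ModularGroup.T • τ) = heckeFun p w f τ := by
    have h1 : ((ModularGroup.T • τ : ℍ) : ℂ) = τ + 1 := by
      rw [coe_specialLinearGroup_apply]
      simp [ModularGroup.T]
    rw [heckeFun, heckeFun, h1]
    congr 1
    · rw [mul_add, mul_one]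
      rw [← levelOne_apply_add_int f (im_natCast_mul_pos hp τ.im_pos) p]
      simp
    · have h2 : ∀ i : ℕ, f (ofComplex ((τ + 1 + i) / p)) = f (ofComplex ((τ + (i + 1 : ℕ)) / p)) := by
        intro i
        congr 3
        push_cast
        ring
      simp only [h2]
      have h3 := Finset.sum_range_succ (fun i : ℕ => f (ofComplex (((τ : ℂ) + i) / p))) p
      rw [Finset.sum_range_succ'] at h3
      have h4 : f (ofComplex (((τ : ℂ) + p) / p)) = f (ofComplex (((τ : ℂ) + (0 : ℕ)) / p)) := by
        rw [← levelOne_apply_add_int f (im_add_div_natCast_pos hp τ.im_pos 0) 1]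
        congr 2
        field_simp
        push_cast
        ring
      rw [h4] at h3
      exact add_right_cancel h3
  rw [SL_slash_apply, key, ModularGroup.denom_apply]
  simp [ModularGroup.T]

/-- Under `τ ↦ -1 / τ` the term `f (p τ)` and the term `i = 0` are exchanged, while the terms with
`i` prime to `p` are permuted by `i ↦ -1 / i` modulo `p`. -/
theorem heckeFun_slash_S {p : ℕ} (hp : p.Prime) (f : ModularForm 𝒮ℒ (w : ℤ)) :
    heckeFun p w f ∣[(w : ℤ)] ModularGroup.S = heckeFun p w f := by
  ext τ
  have : Fact p.Prime := ⟨hp⟩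
  have hp0 : (p : ℂ) ≠ 0 := by exact_mod_cast hp.ne_zero
  have hτ : (τ : ℂ) ≠ 0 := UpperHalfPlane.ne_zero τ
  have hrange (g : ℕ → ℂ) : ∑ i ∈ Finset.range p, g i =
      g 0 + ∑ u : (ZMod p)ˣ, g (u : ZMod p).val := by
    have h1 : ∑ i ∈ Finset.range p, g i = ∑ x : ZMod p, g x.val := by
      refine Finset.sum_nbij' (fun i => (i : ZMod p)) (fun x => x.val) ?_ ?_ ?_ ?_ ?_
      · simp
      · intro x _
        simpa using ZMod.val_lt x
      · intro i hi
        exact ZMod.val_cast_of_lt (by simpa using hi)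
      · intro x _
        simp
      · intro i hi
        rw [ZMod.val_cast_of_lt (by simpa using hi)]
    rw [h1, ← Finset.add_sum_erase _ _ (Finset.mem_univ (0 : ZMod p)), ZMod.val_zero]
    congr 1
    refine (Finset.sum_bij (fun (u : (ZMod p)ˣ) _ => (u : ZMod p)) ?_ ?_ ?_ ?_).symm
    · intro u _
      simp
    · intro u _ v _ h
      exact Units.ext h
    · intro x hx
      exact ⟨Units.mk0 x (by simpa using hx), Finset.mem_univ _, rfl⟩
    · intros
      rfl
  have h1 : ((ModularGroup.S • τ : ℍ) : ℂ) = -1 / τ := by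
    rw [coe_specialLinearGroup_apply]
    simp [ModularGroup.S]
  have key : heckeFun p w f (ModularGroup.S • τ) = τ ^ w * heckeFun p w f τ := by
    have hA : (p : ℂ) ^ w * f (ofComplex (p * (-1 / τ))) =
        τ ^ w * f (ofComplex ((τ + (0 : ℕ)) / p)) := by
      rw [levelOne_apply_moebius f (a := 0) (b := -1) (c := 1) (d := 0) (by ring)
        (im_add_div_natCast_pos hp.pos τ.im_pos 0)
        (by
          simp only [Nat.cast_zero, Int.cast_zero, Int.cast_one, Int.cast_neg, add_zero, zero_mul,
            zero_add, one_mul]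
          field_simp), ← mul_assoc, ← mul_pow]
      congr 2
      push_cast
      field_simp
      ring
    have hB : f (ofComplex ((-1 / τ + (0 : ℕ)) / p)) = τ ^ w * (p ^ w * f (ofComplex (p * τ))) := by
      rw [levelOne_apply_moebius f (a := 0) (b := -1) (c := 1) (d := 0) (by ring)
        (im_natCast_mul_pos hp.pos τ.im_pos)
        (by
          push_cast
          field_simp
          ring), ← mul_assoc ((τ : ℂ) ^ w), ← mul_pow]
      congr 2
      push_cast
      ring
    have hC (u : (ZMod p)ˣ) : f (ofComplex ((-1 / τ + (u : ZMod p).val) / p)) =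
        τ ^ w * f (ofComplex ((τ + ((-u⁻¹ : (ZMod p)ˣ) : ZMod p).val) / p)) := by
      set i := (u : ZMod p).val with hi
      set j := ((-u⁻¹ : (ZMod p)ˣ) : ZMod p).val with hj
      have hij : ((i * j + 1 : ℕ) : ZMod p) = 0 := by
        push_cast
        rw [hi, hj, ZMod.natCast_zmod_val, ZMod.natCast_zmod_val, ← Units.val_mul, mul_neg,
          mul_inv_cancel]
        simp
      obtain ⟨m, hm⟩ := (ZMod.natCast_eq_zero_iff _ _).1 hij
      have hmZ : (i : ℤ) * j + 1 = p * m := by exact_mod_cast hm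
      have hmC : (i : ℂ) * j + 1 = p * m := by exact_mod_cast hm
      have hd : ((p : ℤ) : ℂ) * ((τ + j) / p) + ((-j : ℤ) : ℂ) = τ := by
        push_cast
        field_simp
        ring
      -- With `i * j + 1 = p * m` this matrix has determinant 1 and sends `(τ + j) / p` to `(-1 / τ
      -- + i) / p`; its automorphy factor is `τ`.
      rw [levelOne_apply_moebius f (a := i) (b := -m) (c := p) (d := -j)
        (by linear_combination -hmZ) (im_add_div_natCast_pos hp.pos τ.im_pos j)
        (by
          rw [hd]
          push_cast
          field_simp
          linear_combination -hmC), hd]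
    rw [heckeFun, heckeFun, h1, hrange, hrange, hA, hB]
    simp only [hC, mul_add, Finset.mul_sum]
    rw [← Equiv.sum_comp ((Equiv.inv (ZMod p)ˣ).trans (Equiv.neg _))]
    simp only [Equiv.trans_apply, Equiv.inv_apply, Equiv.neg_apply]
    have : ∀ u : (ZMod p)ˣ, -(-u⁻¹)⁻¹ = u := by simp
    simp only [this]
    ring
  rw [SL_slash_apply, key, ModularGroup.denom_S]
  rw [zpow_neg, zpow_natCast]
  field_simp

theorem mdifferentiable_heckeFun {p : ℕ} (hp : 0 < p) (f : ModularForm 𝒮ℒ (w : ℤ)) :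
    DifferentiableOn ℂ (heckeFun p w f ∘ ofComplex) {z | 0 < z.im} := by
  have hf := differentiableOn_levelOne f
  have h : DifferentiableOn ℂ (fun z : ℂ => (p : ℂ) ^ w * f (ofComplex (p * z)) +
      ∑ i ∈ Finset.range p, f (ofComplex ((z + i) / p))) {z | 0 < z.im} := by
    refine DifferentiableOn.add (DifferentiableOn.const_mul ?_ _)
      (DifferentiableOn.fun_sum fun i _ => ?_)
    · exact hf.comp (g := fun z => f (ofComplex z)) (f := fun z : ℂ => (p : ℂ) * z) (by fun_prop)
        fun z hz => im_natCast_mul_pos hp hz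
    · exact hf.comp (g := fun z => f (ofComplex z)) (f := fun z : ℂ => (z + i) / p) (by fun_prop)
        fun z hz => im_add_div_natCast_pos hp hz i
  refine h.congr fun z hz => ?_
  simp [heckeFun, ofComplex_apply_of_im_pos (show 0 < z.im from hz)]

theorem sum_range_exp_div {p : ℕ} (hp : 0 < p) (m : ℕ) :
    ∑ i ∈ Finset.range p, exp (2 * Real.pi * I * (i / p) * m) = if p ∣ m then (p : ℂ) else 0 := by
  have hp0 : (p : ℂ) ≠ 0 := by exact_mod_cast hp.ne'
  have hζ := Complex.isPrimitiveRoot_exp p hp.ne'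
  set ζ := exp (2 * Real.pi * I / p) with hζdef
  have h1 : ∀ i : ℕ, exp (2 * Real.pi * I * (i / p) * m) = (ζ ^ m) ^ i := by
    intro i
    rw [hζdef, ← exp_nat_mul, ← exp_nat_mul]
    congr 1
    ring
  simp only [h1]
  split_ifs with h
  · rw [(hζ.pow_eq_one_iff_dvd m).2 h]
    simp
  · have h2 : ζ ^ m ≠ 1 := fun h' => h ((hζ.pow_eq_one_iff_dvd m).1 h')
    rw [geom_sum_eq h2, ← pow_mul, mul_comm, pow_mul, hζ.pow_eq_one]
    simp

theorem hasSum_heckeFun {p : ℕ} (hp : 0 < p) (f : ModularForm 𝒮ℒ (w : ℤ)) (τ : ℍ) :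
    HasSum (fun m : ℕ => (p * (qExpansion 1 f).coeff (p * m) +
        p ^ w * if p ∣ m then (qExpansion 1 f).coeff (m / p) else 0) •
        Function.Periodic.qParam 1 τ ^ m) (heckeFun p w f τ) := by
  set a := fun m => (qExpansion 1 f).coeff m with ha
  have hp0 : (p : ℂ) ≠ 0 := by exact_mod_cast hp.ne'
  have hq (m : ℕ) : Function.Periodic.qParam 1 τ ^ m = exp (2 * Real.pi * I * τ * m) := by
    rw [Function.Periodic.qParam, ← Complex.exp_nat_mul]
    congr 1
    simp
    ring
  have hinj : Function.Injective fun m : ℕ => p * m := fun x y h => Nat.eq_of_mul_eq_mul_left hp h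
  have h1 : HasSum (fun m : ℕ => (p * a (p * m)) • Function.Periodic.qParam 1 τ ^ m)
      (∑ i ∈ Finset.range p, f (ofComplex ((τ + i) / p))) := by
    have hs := hasSum_sum (s := Finset.range p) fun i _ =>
      hasSum_levelOne f (im_add_div_natCast_pos hp τ.im_pos i)
    have hterm (m : ℕ) : ∑ i ∈ Finset.range p, a m * exp (2 * Real.pi * I * ((τ + i) / p) * m) =
        if p ∣ m then p * a m * exp (2 * Real.pi * I * (τ / p) * m) else 0 := by
      have : ∀ i : ℕ, a m * exp (2 * Real.pi * I * ((τ + i) / p) * m) =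
          a m * exp (2 * Real.pi * I * (τ / p) * m) * exp (2 * Real.pi * I * (i / p) * m) := by
        intro i
        rw [mul_assoc (a m), ← exp_add]
        congr 2
        ring
      simp only [this]
      rw [← Finset.mul_sum, sum_range_exp_div hp]
      split_ifs <;> ring
    change HasSum (fun m => ∑ i ∈ Finset.range p, a m * exp (2 * Real.pi * I * ((τ + i) / p) * m)) _
      at hs
    simp only [hterm] at hs
    rw [← hinj.hasSum_iff] at hs
    · convert hs using 1
      funext m
      simp only [Function.comp_apply, dvd_mul_right, if_true, smul_eq_mul]
      rw [hq]
      congr 2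
      push_cast
      field_simp
    · intro m hm
      rw [if_neg]
      rintro ⟨k, rfl⟩
      exact hm ⟨k, rfl⟩
  have h2 : HasSum (fun m : ℕ => (p ^ w * if p ∣ m then a (m / p) else 0) •
      Function.Periodic.qParam 1 τ ^ m) (p ^ w * f (ofComplex (p * τ))) := by
    have hs := (hasSum_levelOne f (im_natCast_mul_pos hp τ.im_pos)).mul_left ((p : ℂ) ^ w)
    rw [← hinj.hasSum_iff]
    · refine hs.congr_fun fun m => ?_
      simp only [Function.comp_apply, dvd_mul_right, if_true, smul_eq_mul]
      rw [hq, Nat.mul_div_cancel_left _ hp, mul_assoc]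
      congr 3
      push_cast
      ring
    · intro m hm
      rw [if_neg]
      · simp
      rintro ⟨k, rfl⟩
      exact hm ⟨k, rfl⟩
  refine (h2.add h1).congr_fun fun m => ?_
  simp only [ha, smul_eq_mul]
  ring

/-- `p` times the classical Hecke operator `T_p` on level one forms of weight `w`. -/
def heckeForm {p : ℕ} (hp : p.Prime) (f : ModularForm 𝒮ℒ (w : ℤ)) : ModularForm 𝒮ℒ (w : ℤ) where
  toFun := heckeFun p w f
  slash_action_eq' := by
    rintro _ ⟨γ, rfl⟩
    exact SlashInvariantForm.slash_action_generators_SL2Z (heckeFun_slash_S hp f)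
      (heckeFun_slash_T hp.pos f) γ
  holo' := UpperHalfPlane.mdifferentiable_iff.2 (mdifferentiable_heckeFun hp.pos f)
  bdd_at_cusps' {c} hc := by
    rw [Subgroup.IsArithmetic.isCusp_iff_isCusp_SL2Z] at hc
    rw [OnePoint.isBoundedAt_iff_forall_SL2Z hc]
    intro γ _
    rw [SlashInvariantForm.slash_action_generators_SL2Z (heckeFun_slash_S hp f)
      (heckeFun_slash_T hp.pos f) γ]
    exact UpperHalfPlane.isBoundedAtImInfty_of_hasSum_qExpansion one_pos (hasSum_heckeFun hp.pos f)

theorem coeff_qExpansion_heckeForm {p : ℕ} (hp : p.Prime) (f : ModularForm 𝒮ℒ (w : ℤ)) (m : ℕ) :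
    (qExpansion 1 (heckeForm hp f)).coeff m = p * (qExpansion 1 f).coeff (p * m) +
      p ^ w * if p ∣ m then (qExpansion 1 f).coeff (m / p) else 0 :=
  (ModularFormClass.qExpansion_coeff_unique one_pos one_mem_strictPeriods_SL
    (f := heckeForm hp f) (hasSum_heckeFun hp.pos f) m).symm

end LevelOneHecke

end ModTwoForms

end

noncomputable section

namespace ModTwoForms

open PowerSeries

/-! ### The discriminant reduces to `Δ` modulo 2 -/

section DiscriminantReduction

open ArithmeticFunction.sigma

/-- The generating series of the divisor power sums `σ k`, with integer coefficients. -/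
def sigmaSeries (k : ℕ) : PowerSeries ℤ := mk fun n => (σ k n : ℤ)

/-- The `q`-expansion of the discriminant, with integer coefficients. -/
def discriminantSeries : PowerSeries ℤ :=
  mk (fun n => (((5 * σ 3 n + 7 * σ 5 n) / 12 : ℕ) : ℤ)) + 100 * sigmaSeries 3 ^ 2 +
    8000 * sigmaSeries 3 ^ 3 - 147 * sigmaSeries 5 ^ 2

/-- The modulus 24 gives both divisibility by 12, for integrality of the discriminant, and the
parity of the quotient, for its reduction. -/
theorem five_mul_pow_three_add_mod (d : ℕ) : (5 * d ^ 3 + 7 * d ^ 5) % 24 = 12 * (d % 2) := by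
  have h : ∀ r < 24, (5 * r ^ 3 + 7 * r ^ 5) % 24 = 12 * (r % 2) := by decide
  have h1 := h (d % 24) (Nat.mod_lt _ (by norm_num))
  rw [Nat.mod_mod_of_dvd _ (by norm_num)] at h1
  rw [← h1]
  simp [Nat.add_mod, Nat.mul_mod, Nat.pow_mod]

theorem five_mul_sigma_add (n : ℕ) :
    5 * σ 3 n + 7 * σ 5 n = 12 * ∑ d ∈ n.divisors, (5 * d ^ 3 + 7 * d ^ 5) / 12 := by
  rw [ArithmeticFunction.sigma_apply, ArithmeticFunction.sigma_apply, Finset.mul_sum,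
    Finset.mul_sum, Finset.mul_sum, ← Finset.sum_add_distrib]
  refine Finset.sum_congr rfl fun d _ => ?_
  have := five_mul_pow_three_add_mod d
  omega

theorem natCast_sigma_zmod_two {k : ℕ} (hk : k ≠ 0) (n : ℕ) : (σ k n : ZMod 2) = σ 1 n := by
  rw [ArithmeticFunction.sigma_apply, ArithmeticFunction.sigma_apply]
  push_cast
  refine Finset.sum_congr rfl fun d _ => ?_
  have h : ∀ x : ZMod 2, x = 0 ∨ x = 1 := by decide
  rcases h d with h | h
  · simp [h, hk]
  · simp [h]

theorem natCast_five_mul_sigma_add_div (n : ℕ) :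
    (((5 * σ 3 n + 7 * σ 5 n) / 12 : ℕ) : ZMod 2) = σ 1 n := by
  rw [five_mul_sigma_add, Nat.mul_div_cancel_left _ (by norm_num), ArithmeticFunction.sigma_apply]
  push_cast
  refine Finset.sum_congr rfl fun d _ => ?_
  rw [pow_one]
  refine natCast_zmod_two_eq_of_odd_iff ?_
  have := five_mul_pow_three_add_mod d
  rw [Nat.odd_iff, Nat.odd_iff]
  omega

theorem natCast_sigma_one_of_odd {n : ℕ} (hn : Odd n) :
    (σ 1 n : ZMod 2) = if IsSquare n then 1 else 0 := by
  have hn0 : n ≠ 0 := hn.pos.ne'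
  have h1 : (σ 1 n : ZMod 2) = (n.divisors.card : ZMod 2) := by
    rw [ArithmeticFunction.sigma_apply, Finset.card_eq_sum_ones]
    push_cast
    refine Finset.sum_congr rfl fun d hd => ?_
    have hd : Odd d := hn.of_dvd_nat (Nat.dvd_of_mem_divisors hd)
    rw [pow_one]
    exact_mod_cast natCast_zmod_two_eq_of_odd_iff (b := 1) (by simp [hd])
  rw [h1, natCast_card_eq_of_involution n.divisors (fun d => n / d)
    (fun d hd => Nat.mem_divisors.2 ⟨Nat.div_dvd_of_dvd (Nat.dvd_of_mem_divisors hd), hn0⟩)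
    (fun d hd => Nat.div_div_self (Nat.dvd_of_mem_divisors hd) hn0)]
  have hfix (d : ℕ) : d ∈ n.divisors.filter (fun d => n / d = d) ↔ n = d * d := by
    simp only [Finset.mem_filter, Nat.mem_divisors]
    constructor
    · rintro ⟨⟨hd, -⟩, h⟩
      conv_lhs => rw [← Nat.div_mul_cancel hd, h]
    · rintro rfl
      exact ⟨⟨dvd_mul_right _ _, hn0⟩, Nat.mul_div_cancel_left _ (Nat.pos_of_ne_zero (by
        rintro rfl
        simp at hn0))⟩
  split_ifs with hs
  · obtain ⟨r, hr⟩ := hs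
    have : n.divisors.filter (fun d => n / d = d) = {r} := by
      ext d
      rw [hfix, Finset.mem_singleton, hr]
      exact ⟨fun h => (Nat.mul_self_inj.1 h).symm, fun h => by rw [h]⟩
    rw [this]
    simp
  · have : n.divisors.filter (fun d => n / d = d) = ∅ := by
      ext d
      rw [hfix]
      simp only [Finset.notMem_empty, iff_false]
      exact fun h => hs ⟨d, h⟩
    rw [this]
    simp

theorem natCast_sigma_one_two_mul (m : ℕ) : (σ 1 (2 * m) : ZMod 2) = σ 1 m := by
  rcases eq_or_ne m 0 with rfl | hm
  · simp
  rw [ArithmeticFunction.sigma_apply, ArithmeticFunction.sigma_apply]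
  push_cast
  refine (Finset.sum_subset (Nat.divisors_subset_of_dvd (by positivity) (dvd_mul_left m 2))
    fun d hd hd' => ?_).symm
  rw [pow_one, ZMod.natCast_eq_zero_iff]
  by_contra h
  have hcop : Nat.Coprime d 2 := (Nat.prime_two.coprime_iff_not_dvd.2 h).symm
  exact hd' (Nat.mem_divisors.2 ⟨hcop.dvd_of_dvd_mul_left (Nat.dvd_of_mem_divisors hd), hm⟩)

/-- Modulo 2 the `n`-th coefficient is `σ 1 n`, plus `σ 1 (n / 2)` for even `n`, the latter from the
square of `sigmaSeries 5`. The two cancel for even `n`; for odd `n` the number of divisors is odd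
exactly at squares. -/
theorem map_discriminantSeries_zmod_two :
    map (Int.castRingHom (ZMod 2)) discriminantSeries = Delta := by
  set R := map (Int.castRingHom (ZMod 2)) with hR
  have h100 : R 100 = 0 := by
    rw [map_ofNat]
    exact (CharP.cast_eq_zero_iff (PowerSeries (ZMod 2)) 2 100).2 (by norm_num)
  have h8000 : R 8000 = 0 := by
    rw [map_ofNat]
    exact (CharP.cast_eq_zero_iff (PowerSeries (ZMod 2)) 2 8000).2 (by norm_num)
  have h147 : R 147 = 1 := by
    have h : ((146 : ℕ) : PowerSeries (ZMod 2)) = 0 :=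
      (CharP.cast_eq_zero_iff (PowerSeries (ZMod 2)) 2 146).2 (by norm_num)
    rw [map_ofNat]
    calc (147 : PowerSeries (ZMod 2)) = ((146 : ℕ) : PowerSeries (ZMod 2)) + 1 := by norm_num
      _ = 1 := by rw [h, zero_add]
  rw [discriminantSeries, map_sub, map_add, map_add, map_mul, map_mul, map_mul, h100, h8000, h147,
    zero_mul, zero_mul, add_zero, add_zero, one_mul, map_pow, sq_eq_expand]
  ext n
  rw [map_sub, coeff_Delta, CharTwo.sub_eq_add, coeff_expand]
  simp only [hR, coeff_map, sigmaSeries, coeff_mk, eq_intCast, Int.cast_natCast]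
  rw [natCast_five_mul_sigma_add_div, natCast_sigma_zmod_two (k := 5) (by norm_num)]
  rcases Nat.even_or_odd n with hn | hn
  · obtain ⟨m, rfl⟩ := even_iff_two_dvd.1 hn
    rw [if_pos (dvd_mul_right 2 m), if_neg (by simp), Nat.mul_div_cancel_left _ two_pos,
      natCast_sigma_one_two_mul, CharTwo.add_self_eq_zero]
  · rw [if_neg (by rw [← even_iff_two_dvd]; simpa using hn), natCast_sigma_one_of_odd hn, add_zero]
    simp [hn]

end DiscriminantReduction

end ModTwoForms

end

noncomputable section

namespace ModTwoForms

open PowerSeries UpperHalfPlane ModularForm EisensteinSeries MatrixGroups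

/-! ### Integral forms reduce to polynomials in `Δ` -/

section IntegralExpansions

/-- The embedding of integral power series into complex ones. -/
abbrev toComplexSeries : PowerSeries ℤ →+* PowerSeries ℂ := map (Int.castRingHom ℂ)

/-- The reduction modulo `2` of integral power series. -/
abbrev modTwo : PowerSeries ℤ →+* PowerSeries (ZMod 2) := map (Int.castRingHom (ZMod 2))

theorem qExpansion_E_four :
    qExpansion 1 E₄ = toComplexSeries (1 + 240 * sigmaSeries 3) := by
  ext n
  rw [E_qExpansion_coeff _ ⟨2, rfl⟩, show bernoulli 4 = -1 / 30 by decide +kernel, map_add,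
    map_mul, map_one, map_ofNat, ← map_ofNat (C (R := ℂ)), map_add, coeff_C_mul, coeff_one]
  rcases eq_or_ne n 0 with rfl | hn
  · simp [sigmaSeries]
  · norm_num [hn, sigmaSeries]

theorem qExpansion_E_six :
    qExpansion 1 E₆ = toComplexSeries (1 - 504 * sigmaSeries 5) := by
  ext n
  rw [E_qExpansion_coeff _ ⟨3, rfl⟩, show bernoulli 6 = 1 / 42 by decide +kernel, map_sub,
    map_mul, map_one, map_ofNat, ← map_ofNat (C (R := ℂ)), map_sub, coeff_C_mul, coeff_one]
  rcases eq_or_ne n 0 with rfl | hn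
  · simp [sigmaSeries]
  · norm_num [hn, sigmaSeries]

theorem twelve_mul_mk_five_mul_sigma_add :
    (12 : PowerSeries ℤ) * mk (fun n => (((5 * ArithmeticFunction.sigma 3 n +
      7 * ArithmeticFunction.sigma 5 n) / 12 : ℕ) : ℤ)) =
      5 * sigmaSeries 3 + 7 * sigmaSeries 5 := by
  ext n
  rw [← map_ofNat (C (R := ℤ)) 12, ← map_ofNat (C (R := ℤ)) 5, ← map_ofNat (C (R := ℤ)) 7, map_add,
    coeff_C_mul, coeff_C_mul, coeff_C_mul]
  simp only [sigmaSeries, coeff_mk]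
  have h : (12 : ℤ) * (((5 * ArithmeticFunction.sigma 3 n +
      7 * ArithmeticFunction.sigma 5 n) / 12 : ℕ) : ℤ) =
      5 * ArithmeticFunction.sigma 3 n + 7 * ArithmeticFunction.sigma 5 n := by
    exact_mod_cast Nat.mul_div_cancel' ⟨_, five_mul_sigma_add n⟩
  exact h

theorem qExpansion_discriminant :
    qExpansion 1 ModularForm.discriminant = toComplexSeries discriminantSeries := by
  let g : ModularForm 𝒮ℒ 12 :=
    ModularForm.mcast (by decide) (E₄.pow 3) - ModularForm.mcast (by decide) (E₆.pow 2)
  have hg : qExpansion 1 g = qExpansion 1 E₄ ^ 3 - qExpansion 1 E₆ ^ 2 := by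
    simp only [g, FunLike.coe_sub, coe_mcast,
      ModularForm.qExpansion_sub one_pos one_mem_strictPeriods_SL,
      ModularForm.qExpansion_pow one_pos one_mem_strictPeriods_SL]
  have hfun : ((1728 : ℂ) • CuspForm.discriminant : ℍ → ℂ) = g := by
    ext z
    simp only [g, Pi.smul_apply, CuspForm.coe_discriminant, smul_eq_mul, sub_apply,
      coe_mcast, ModularForm.coe_pow, Pi.pow_apply]
    rw [discriminant_eq_E₄_cube_sub_E₆_sq]
    ring
  have h1 := ModularForm.qExpansion_smul one_pos one_mem_strictPeriods_SL (1728 : ℂ)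
    CuspForm.discriminant
  rw [hfun, hg, qExpansion_E_four, qExpansion_E_six, ← map_pow, ← map_pow, ← map_sub] at h1
  -- Expanding, the linear part is `144 * (5 * sigmaSeries 3 + 7 * sigmaSeries 5)`, and `1728 = 144
  -- * 12`; this accounts for the quotient by 12 in `discriminantSeries`.
  have h2 : (1 + 240 * sigmaSeries 3) ^ 3 - (1 - 504 * sigmaSeries 5) ^ 2 =
      1728 * discriminantSeries := by
    rw [discriminantSeries]
    linear_combination (-144) * twelve_mul_mk_five_mul_sigma_add
  rw [h2, map_mul, map_ofNat, smul_eq_C_mul, map_ofNat] at h1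
  have h3 : (1728 : PowerSeries ℂ) ≠ 0 := by
    rw [← map_ofNat (C (R := ℂ)), Ne, map_eq_zero_iff _ C_injective]
    norm_num
  exact (mul_left_cancel₀ h3 h1).symm

/-- The series is `q` times a unit over `ℤ`, its first coefficient being 1. Dividing a form by the
discriminant thus keeps its coefficients integral. -/
theorem discriminantSeries_dvd {P : PowerSeries ℤ} (hP : constantCoeff P = 0) :
    discriminantSeries ∣ P := by
  have hcoeff (n : ℕ) : ((coeff n discriminantSeries : ℤ) : ℂ) =
      coeff n (qExpansion 1 ModularForm.discriminant) := by
    rw [qExpansion_discriminant, coeff_map, eq_intCast]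
  have h0 : constantCoeff discriminantSeries = 0 := by
    rw [← coeff_zero_eq_constantCoeff_apply]
    have h := hcoeff 0
    rw [coeff_of_lt_order (φ := qExpansion 1 ModularForm.discriminant) 0
      (by rw [discriminant_qExpansion_order]; exact zero_lt_one)] at h
    exact_mod_cast h
  obtain ⟨V, hV⟩ := X_dvd_iff.2 h0
  have hV0 : constantCoeff V = 1 := by
    rw [← coeff_zero_eq_constantCoeff_apply, ← coeff_succ_X_mul, ← hV]
    have h := hcoeff 1
    rw [discriminant_qExpansion_coeff_one] at h
    exact_mod_cast h
  have hVu : IsUnit V := isUnit_iff_constantCoeff.2 (by rw [hV0]; exact isUnit_one)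
  rw [hV, hVu.mul_right_dvd]
  exact X_dvd_iff.2 hP

/-- The span of the powers of `Δ` up to the `k`-th. -/
def powersUpTo (k : ℕ) : Submodule (ZMod 2) (PowerSeries (ZMod 2)) :=
  Submodule.span (ZMod 2) ((fun j => Delta ^ j) '' Set.Iic k)

theorem Delta_pow_mem_powersUpTo {j k : ℕ} (h : j ≤ k) : Delta ^ j ∈ powersUpTo k :=
  Submodule.subset_span ⟨j, h, rfl⟩

theorem Delta_mul_mem_powersUpTo {k : ℕ} {f : PowerSeries (ZMod 2)} (hf : f ∈ powersUpTo k) :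
    Delta * f ∈ powersUpTo (k + 1) := by
  induction hf using Submodule.span_induction with
  | mem x hx =>
    obtain ⟨j, hj, rfl⟩ := hx
    change Delta * Delta ^ j ∈ _
    rw [← pow_succ']
    exact Delta_pow_mem_powersUpTo (Nat.succ_le_succ hj)
  | zero =>
    rw [mul_zero]
    exact zero_mem _
  | add x y _ _ hx hy =>
    rw [mul_add]
    exact add_mem hx hy
  | smul a x _ hx =>
    rw [mul_smul_comm]
    exact Submodule.smul_mem _ a hx

/-- A level one form of weight `12 k` with integral `q`-expansion reduces modulo `2` to a
polynomial in `Δ` of degree at most `k`. -/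
theorem modTwo_mem_powersUpTo (k : ℕ) :
    ∀ (f : ModularForm 𝒮ℒ ((12 * k : ℕ) : ℤ)) (P : PowerSeries ℤ),
      qExpansion 1 f = toComplexSeries P → modTwo P ∈ powersUpTo k := by
  induction k with
  | zero =>
    intro f P hfP
    let f0 : ModularForm 𝒮ℒ 0 := ModularForm.mcast (by simp) f
    obtain ⟨c, hc⟩ := ModularFormClass.levelOne_weight_zero_const f0
    have h1 : (f : ℍ → ℂ) = c • ((1 : ModularForm 𝒮ℒ 0) : ℍ → ℂ) := by
      change (f0 : ℍ → ℂ) = _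
      rw [hc]
      ext z
      simp
    rw [h1, ModularForm.qExpansion_smul one_pos one_mem_strictPeriods_SL,
      ModularForm.qExpansion_one] at hfP
    have h2 : P = C (constantCoeff P) := by
      ext n
      rcases eq_or_ne n 0 with rfl | hn
      · simp
      · have h3 := congrArg (coeff n) hfP
        rw [coeff_smul, coeff_one, if_neg hn, smul_zero, coeff_map, eq_intCast] at h3
        rw [coeff_C, if_neg hn]
        exact_mod_cast h3.symm
    rw [h2, map_C, ← mul_one (C _), ← smul_eq_C_mul]
    exact Submodule.smul_mem _ _ (by simpa using Delta_pow_mem_powersUpTo (le_refl 0))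
  | succ k ih =>
    intro f P hfP
    set a : ℤ := constantCoeff P with ha
    -- This power of `E₄` has the weight of `f`, constant term 1 and reduction 1. Subtracting its
    -- multiple by `a` leaves a form divisible by the discriminant, with quotient of weight `12 k`.
    set Z : PowerSeries ℤ := (1 + 240 * sigmaSeries 3) ^ (3 * (k + 1)) with hZ
    let E : ModularForm 𝒮ℒ ((12 * (k + 1) : ℕ) : ℤ) :=
      ModularForm.mcast (by push_cast; ring) (E₄.pow (3 * (k + 1)))
    have hE : qExpansion 1 E = toComplexSeries Z := by
      rw [hZ, map_pow, ← qExpansion_E_four]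
      exact ModularForm.qExpansion_pow one_pos one_mem_strictPeriods_SL E₄ _
    have hZ0 : constantCoeff Z = 1 := by
      rw [hZ, map_pow, map_add, map_mul, map_one,
        ← coeff_zero_eq_constantCoeff_apply (sigmaSeries 3)]
      simp [sigmaSeries]
    have hP0 : constantCoeff (P - C a * Z) = 0 := by
      rw [map_sub, map_mul, hZ0, constantCoeff_C, mul_one, sub_self]
    obtain ⟨Q, hQ⟩ := discriminantSeries_dvd hP0
    let g : ModularForm 𝒮ℒ ((12 * (k + 1) : ℕ) : ℤ) := f - (a : ℂ) • E
    have hg : qExpansion 1 g = toComplexSeries (P - C a * Z) := by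
      simp only [g, FunLike.coe_sub, FunLike.coe_smul]
      rw [← FunLike.coe_smul, ModularForm.qExpansion_sub one_pos one_mem_strictPeriods_SL,
        FunLike.coe_smul, ModularForm.qExpansion_smul one_pos one_mem_strictPeriods_SL, hfP, hE,
        map_sub, map_mul, map_C, smul_eq_C_mul, eq_intCast]
    have hg0 : (qExpansion 1 g).coeff 0 = 0 := by
      rw [hg, coeff_map, coeff_zero_eq_constantCoeff_apply, hP0, map_zero]
    let h : ModularForm 𝒮ℒ ((12 * k : ℕ) : ℤ) :=
      ModularForm.mcast (by push_cast; ring) (CuspForm.discriminantEquiv (toCuspForm g hg0))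
    have hh : qExpansion 1 h = toComplexSeries Q := by
      have h1 : qExpansion 1 g = qExpansion 1 ModularForm.discriminant * qExpansion 1 h :=
        qExpansion_eq_qExpansion_discriminant_mul g hg0
      rw [hg, hQ, map_mul, ← qExpansion_discriminant] at h1
      refine (mul_left_cancel₀ ?_ h1).symm
      intro h0
      have := discriminant_qExpansion_coeff_one
      rw [h0] at this
      simp at this
    have hZ2 : modTwo Z = 1 := by
      have h240 : modTwo 240 = 0 := by
        rw [map_ofNat]
        exact (CharP.cast_eq_zero_iff (PowerSeries (ZMod 2)) 2 240).2 (by norm_num)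
      rw [hZ, map_pow, map_add, map_mul, h240, map_one, zero_mul, add_zero, one_pow]
    have hPeq : P = discriminantSeries * Q + C a * Z := by rw [← hQ, sub_add_cancel]
    rw [hPeq, map_add, map_mul, map_mul, hZ2, map_C, map_discriminantSeries_zmod_two,
      ← smul_eq_C_mul]
    refine add_mem (Delta_mul_mem_powersUpTo (ih h Q hh)) (Submodule.smul_mem _ _ ?_)
    simpa using Delta_pow_mem_powersUpTo (Nat.zero_le (k + 1))

end IntegralExpansions

/-! ### Stability of `F n` under the Hecke operators -/

section Stability

/-- Apply `p T_p` to the `k`-th power of the discriminant. The factors `p` and `p ^ (12 k)` are both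
1 modulo 2, so the result reduces to `T_p (Δ ^ k)`. -/
theorem hecke_Delta_pow_mem_powersUpTo {p : ℕ} (hp : p.Prime) (hp2 : p ≠ 2) (k : ℕ) :
    hecke p (Delta ^ k) ∈ powersUpTo k := by
  let D : ModularForm 𝒮ℒ 12 := CuspForm.toModularFormₗ CuspForm.discriminant
  let f : ModularForm 𝒮ℒ ((12 * k : ℕ) : ℤ) := ModularForm.mcast (by push_cast; ring) (D.pow k)
  have hf : qExpansion 1 f = toComplexSeries (discriminantSeries ^ k) := by
    rw [map_pow, ← qExpansion_discriminant]
    exact ModularForm.qExpansion_pow one_pos one_mem_strictPeriods_SL D k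
  let P : PowerSeries ℤ := mk fun m => p * coeff (p * m) (discriminantSeries ^ k) +
    p ^ (12 * k) * if p ∣ m then coeff (m / p) (discriminantSeries ^ k) else 0
  have hP : qExpansion 1 (heckeForm hp f) = toComplexSeries P := by
    ext m
    rw [coeff_qExpansion_heckeForm, hf, coeff_map, coeff_map, coeff_map]
    simp only [P, coeff_mk, eq_intCast]
    split_ifs <;> push_cast <;> rfl
  have hmod : modTwo P = hecke p (Delta ^ k) := by
    have hodd : (p : ZMod 2) = 1 :=
      ZMod.natCast_eq_one_iff_odd.2 (hp.odd_of_ne_two hp2)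
    ext m
    rw [coeff_hecke, ← map_discriminantSeries_zmod_two, ← map_pow, coeff_map, coeff_map, coeff_map]
    simp only [P, coeff_mk, eq_intCast]
    split_ifs <;> push_cast <;> simp [hodd]
  rw [← hmod]
  exact modTwo_mem_powersUpTo k (heckeForm hp f) P hP

/-- The projection of a power series to its terms of odd degree. -/
def oddPart : PowerSeries (ZMod 2) →ₗ[ZMod 2] PowerSeries (ZMod 2) where
  toFun f := mk fun n => if Odd n then coeff n f else 0
  map_add' f g := by
    ext n
    simp only [coeff_mk, map_add]
    split_ifs <;> simp
  map_smul' c f := by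
    ext n
    simp only [coeff_mk, coeff_smul, RingHom.id_apply]
    split_ifs <;> simp

theorem coeff_oddPart (n : ℕ) (f : PowerSeries (ZMod 2)) :
    coeff n (oddPart f) = if Odd n then coeff n f else 0 :=
  coeff_mk (R := ZMod 2) n fun n => if Odd n then coeff n f else 0

theorem coeff_Delta_even_pow_of_odd (i : ℕ) {n : ℕ} (hn : Odd n) :
    coeff n (Delta ^ (2 * i)) = 0 := by
  rw [mul_comm, pow_mul, sq_eq_expand]
  exact coeff_expand_of_not_dvd _ _ _ (by rw [← even_iff_two_dvd]; simpa using hn)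

theorem coeff_Delta_odd_pow_of_even (i : ℕ) {n : ℕ} (hn : Even n) :
    coeff n (Delta ^ (2 * i + 1)) = 0 := by
  rw [pow_succ, coeff_mul]
  refine Finset.sum_eq_zero fun x hx => ?_
  rw [Finset.HasAntidiagonal.mem_antidiagonal] at hx
  rcases Nat.even_or_odd x.1 with h | h
  · rw [coeff_Delta, if_neg, mul_zero]
    rintro ⟨h2, -⟩
    rw [← hx] at hn
    exact (Nat.not_even_iff_odd.2 (h.add_odd h2)) hn
  · rw [coeff_Delta_even_pow_of_odd i h, zero_mul]

theorem oddPart_mem_F {n : ℕ} {f : PowerSeries (ZMod 2)} (i : Fin n)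
    (hf : f ∈ powersUpTo (2 * (i : ℕ) + 1)) : oddPart f ∈ F n := by
  induction hf using Submodule.span_induction with
  | mem x hx =>
    obtain ⟨j, hj, rfl⟩ := hx
    change oddPart (Delta ^ j) ∈ F n
    obtain ⟨l, rfl | rfl⟩ := Nat.even_or_odd' j
    · have : oddPart (Delta ^ (2 * l)) = 0 := by
        ext m
        rw [coeff_oddPart, map_zero]
        split_ifs with hm
        · exact coeff_Delta_even_pow_of_odd l hm
        · rfl
      rw [this]
      exact zero_mem _
    · have : oddPart (Delta ^ (2 * l + 1)) = Delta ^ (2 * l + 1) := by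
        ext m
        rw [coeff_oddPart]
        split_ifs with hm
        · rfl
        · exact (coeff_Delta_odd_pow_of_even l (Nat.not_odd_iff_even.1 hm)).symm
      rw [this]
      have hl : l < n := by
        have : 2 * l + 1 ≤ 2 * (i : ℕ) + 1 := hj
        have := i.2
        omega
      exact Submodule.subset_span ⟨⟨l, hl⟩, rfl⟩
  | zero =>
    rw [map_zero]
    exact zero_mem _
  | add x y _ _ hx hy =>
    rw [map_add]
    exact add_mem hx hy
  | smul a x _ hx =>
    rw [map_smul]
    exact Submodule.smul_mem _ a hx

theorem heckeStable (n : ℕ) : HeckeStable n := by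
  intro p hp hp2 f hf
  have hodd := hp.odd_of_ne_two hp2
  induction hf using Submodule.span_induction with
  | mem x hx =>
    obtain ⟨i, rfl⟩ := hx
    change hecke p (Delta ^ (2 * (i : ℕ) + 1)) ∈ F n
    -- An odd power of `Δ` has only odd exponents, and `T_p` preserves this for odd `p`. Projecting
    -- to odd exponents thus leaves the series alone but removes the even powers of `Δ` from its
    -- expression.
    have h : oddPart (hecke p (Delta ^ (2 * (i : ℕ) + 1))) =
        hecke p (Delta ^ (2 * (i : ℕ) + 1)) := by
      ext m
      rw [coeff_oddPart]
      split_ifs with hm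
      · rfl
      · rw [Nat.not_odd_iff_even] at hm
        rw [coeff_hecke, coeff_Delta_odd_pow_of_even _ (hm.mul_left p), zero_add]
        split_ifs with hpm
        · refine (coeff_Delta_odd_pow_of_even _ ?_).symm
          obtain ⟨l, rfl⟩ := hpm
          rw [Nat.mul_div_cancel_left _ hp.pos]
          exact (Nat.even_mul.1 hm).resolve_left (Nat.not_even_iff_odd.2 hodd)
        · rfl
    rw [← h]
    exact oddPart_mem_F i (hecke_Delta_pow_mem_powersUpTo hp hp2 _)
  | zero =>
    rw [map_zero]
    exact zero_mem _
  | add x y _ _ hx hy =>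
    rw [map_add]
    exact add_mem hx hy
  | smul a x _ hx =>
    rw [map_smul]
    exact Submodule.smul_mem _ a hx

end Stability

end ModTwoForms

end

theorem proposition2 (n : ℕ) (hn : 0 < n) :
    ∃ h : ModTwoForms.HeckeStable n,
      ModTwoForms.A h =
        Algebra.adjoin (ZMod 2)
          {ModTwoForms.T h 3 (by norm_num) (by norm_num),
            ModTwoForms.T h 5 (by norm_num) (by norm_num)} :=
  ⟨ModTwoForms.heckeStable n, ModTwoForms.A_eq_adjoinThreeFive _⟩
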